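/- **Model.** Let $\mathcal G$ be a DAG on latent variables $L$ and observed variables $X=(X_1,\dots,X_p)$ (finitely many) without edges from observed to latent variables, such that (A1) every observed variable has exactly one latent parent; (A2) every latent variable has at least two children, at least one of which is observed; (A3) there is no edge between observed variables with different latent parents. Attach a real coefficient to each edge, and let every variable equal the sum of (coefficient) $\times$ (parent) over its parents plus its own disturbance. The disturbances are mutually independent, with non-Gaussian continuous laws, finite moments of all orders and nonzero cumulants of every order $\ge 3$. Write $\alpha_{vu}$ for the total effect of $u$ on $v$. A latent source is a latent variable without latent parents. "Generically" means: for all coefficient vectors outside the zero set of some nonzero polynomial in the edge coefficients (which may depend on $\mathcal G$, the disturbances, $k$ and the choice of minor below). **Estimated clusters.** Merge $X_a$ and $X_b$ if one is an ancestor of the other, or if they are dependent and for all other $X_c$ the Triad constraint holds: $\mathrm{Cov}(X_b,X_c)\ne0$ and $X_a-\frac{\mathrm{Cov}(X_a,X_c)}{\mathrm{Cov}(X_b,X_c)}X_b$ is independent of $X_c$. The estimated clusters $\hat C_1,\dots,\hat C_K$ are the classes of the equivalence relation generated by these pairs. Let $X_i$ be a member of $\hat C_i$ that is highest in the causal order (no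 member of $\hat C_i$ is an ancestor of it), let $L_i$ be the latent parent of $X_i$, and let $\bm X_{\mathrm{oc}}=\{X_1,\dots,X_K\}$. Let $\mathcal X_i=\emptyset$ if $|\hat C_i|=1$, and otherwise $\mathcal X_i=\{X_{i'}\}$ for an arbitrary $X_{i'}\in\hat C_i\setminus\{X_i\}$. **Pairwise confounders.** In the canonical model over $X_i$ and $X_j$, the disturbances with proportional nonzero coefficient vectors in $(X_i,X_j)$ are merged into one independent component; $\mathrm{Conf}(X_i,X_j)$ is the set of these components other than the two that contain the disturbance of $X_i$ and that of $X_j$. If it has one element $L^{(i,j)}$, then $c^{(k)}_{(X_i\to X_j)}(L^{(i,j)})$ denotes the second component $c$ of the solution $(c_0,c)$ of $$\alpha_0^m c_0+\alpha_1^m c=\mathrm{cum}^{(k)}(\underbrace{X_i,\dots,X_i}_{k-m},\underbrace{X_j,\dots,X_j}_{m}),\qquad 0\le m\le k-1,$$ where $\alpha_0=\alpha_{ji}$ is the total effect of $X_i$ on $X_j$, and $\alpha_0\neq\alpha_1$ are the two roots in $\alpha$ of a fixed $3\times3$ minor, containing the first row, of $$\begin{pmatrix}1&\alpha&\alpha^2\\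 c^{(3)}_{iii}&c^{(3)}_{iij}&c^{(3)}_{ijj}\\ c^{(4)}_{iiii}&c^{(4)}_{iiij}&c^{(4)}_{iijj}\\ c^{(4)}_{jiii}&c^{(4)}_{jiij}&c^{(4)}_{jijj}\end{pmatrix},$$ the entries being joint cumulants of $X_i$ and $X_j$. (That the two roots exist and are as described is part of the assertion (b) below.) **Corollary.** Let $k\ge3$. Then generically the following holds, whichever minor is used: if the observed variables are pairwise dependent and $K\ge2$, then for every choice of representatives and of $X_{i'}$ and for every $i$, $L_i$ is a latent source of $\mathcal G$ if and only if one of the following two cases holds: 1. $\mathcal X_i=\emptyset$ and $|\bm X_{\mathrm{oc}}\setminus\{X_i\}|=1$; 2. $|(\bm X_{\mathrm{oc}}\cup\mathcal X_i)\setminus\{X_i\}|\ge2$, and (a) $|\mathrm{Conf}(X_i,X_j)|=1$ for every $X_j\in(\bm X_{\mathrm{oc}}\cup\mathcal X_i)\setminus\{X_i\}$ that is dependent on $X_i$, and (b) the values $c^{(k)}_{(X_i\to X_j)}(L^{(i,j)})$ coincide for all $X_j\in(\bm X_{\mathrm{oc}}\cup\mathcal X_i)\setminus\{X_i\}$. 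-/

import Mathlib

open MeasureTheory ProbabilityTheory

/-- The joint cumulant of `Y 0, …, Y (k - 1)`, as the alternating sum over the partitions of the
index set of products of mixed moments. -/
noncomputable def jointCumulant {Ω : Type*} [MeasurableSpace Ω] (μ : Measure Ω) {k : ℕ}
    (Y : Fin k → Ω → ℝ) : ℝ :=
  ∑ π : Finpartition (Finset.univ : Finset (Fin k)),
    (-1 : ℝ) ^ (π.parts.card - 1) * ((π.parts.card - 1).factorial : ℝ) *
      ∏ I ∈ π.parts, ∫ ω, ∏ t ∈ I, Y t ω ∂μ

/-- The cumulant of order `a + b` of `a` copies of `Y` and `b` copies of `Z`. -/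
noncomputable def pairCumulant {Ω : Type*} [MeasurableSpace Ω] (μ : Measure Ω)
    (Y Z : Ω → ℝ) (a b : ℕ) : ℝ :=
  jointCumulant μ (fun t : Fin (a + b) => if t.val < a then Y else Z)

/-- The disturbances of the model: mutually independent random variables with finite moments of all
orders, with non-Gaussian continuous laws, and with nonzero cumulants of every order `≥ 3`. -/
structure IsDisturbance {Ω V : Type*} [MeasurableSpace Ω] (μ : Measure Ω) (η : V → Ω → ℝ) :
    Prop where
  measurable : ∀ v, Measurable (η v)
  indep : iIndepFun η μ
  moments : ∀ v (n : ℕ), MemLp (η v) n μ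
  continuous_law : ∀ v (x : ℝ), μ.map (η v) {x} = 0
  non_gaussian : ∀ v m s, μ.map (η v) ≠ gaussianReal m s
  cumulant_ne_zero : ∀ v (k : ℕ), 3 ≤ k → jointCumulant μ (fun _ : Fin k => η v) ≠ 0

/-- A causal DAG on latent variables `L` and observed variables `O`, in which no observed variable
has a latent child (hence none is an ancestor of a latent variable). `Adj u v` is the
edge `u → v`. -/
structure CausalGraph (L O : Type*) where
  Adj : L ⊕ O → L ⊕ O → Prop
  acyclic : ∀ v, ¬ Relation.TransGen Adj v v
  obs_not_to_latent : ∀ x l, ¬ Adj (Sum.inr x) (Sum.inl l)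

namespace CausalGraph

variable {L O : Type*}

/-- The structural assumptions on the graph: every observed variable has exactly one latent parent;
every latent variable has at least two children, at least one of them observed; there is no edge
between observed variables with different latent parents. -/
structure Admissible (G : CausalGraph L O) : Prop where
  one_latent_parent : ∀ x, ∃! l, G.Adj (Sum.inl l) (Sum.inr x)
  two_children : ∀ l, ∃ c d, c ≠ d ∧ G.Adj (Sum.inl l) c ∧ G.Adj (Sum.inl l) d
  observed_child : ∀ l, ∃ x, G.Adj (Sum.inl l) (Sum.inr x)
  no_edge_between_clusters : ∀ x y l l', G.Adj (Sum.inr x) (Sum.inr y) →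
    G.Adj (Sum.inl l) (Sum.inr x) → G.Adj (Sum.inl l') (Sum.inr y) → l = l'

/-- `X x` is a (proper) ancestor of `X y`. -/
def ObsAnc (G : CausalGraph L O) (x y : O) : Prop :=
  Relation.TransGen G.Adj (Sum.inr x) (Sum.inr y)

/-- A latent source: a latent variable without parents among the latent variables. -/
def IsLatentSource (G : CausalGraph L O) (l : L) : Prop :=
  ∀ l', ¬ G.Adj (Sum.inl l') (Sum.inl l)

/-- The edges of the graph; they index the causal coefficients. -/
abbrev Edge (G : CausalGraph L O) : Type _ :=
  {e : (L ⊕ O) × (L ⊕ O) // G.Adj e.1 e.2}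

open Classical in
/-- The matrix of causal coefficients; the entry `(v, u)` is the coefficient of the edge `u → v`,
and `0` if there is no such edge. -/
noncomputable def coefMatrix (G : CausalGraph L O) (w : G.Edge → ℝ) :
    Matrix (L ⊕ O) (L ⊕ O) ℝ :=
  Matrix.of fun v u => if h : G.Adj u v then w ⟨(u, v), h⟩ else 0

variable [Fintype L] [Fintype O]

open Classical in
/-- The matrix of total effects; the entry `(v, u)` is the total effect of `u` on `v`.
The matrix `1 - coefMatrix` has determinant `1` because the graph is acyclic. -/
noncomputable def totalEffect (G : CausalGraph L O) (w : G.Edge → ℝ) :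
    Matrix (L ⊕ O) (L ⊕ O) ℝ :=
  (1 - G.coefMatrix w)⁻¹

/-- The observed variable `X x`, through the reduced form of the structural equations with
disturbances `η`. -/
noncomputable def obs {Ω : Type*} (G : CausalGraph L O) (w : G.Edge → ℝ) (η : L ⊕ O → Ω → ℝ)
    (x : O) : Ω → ℝ :=
  fun ω => ∑ u, G.totalEffect w (Sum.inr x) u * η u ω

/-! ### The canonical model over two observed variables

In the pair `(X i, X j)`, the disturbance `η m` has the coefficient vector
`(totalEffect i m, totalEffect j m)`. The canonical model merges the disturbances with proportional
nonzero coefficient vectors into one independent component. The class of `η (inr i)` and the class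
of `η (inr j)` are the disturbances `v i` and `v j` of the canonical model, and each of the other
classes is a latent confounder. -/

/-- `η m` occurs in `X i` or in `X j`. -/
def Occurs (G : CausalGraph L O) (w : G.Edge → ℝ) (i j : O) (m : L ⊕ O) : Prop :=
  G.totalEffect w (Sum.inr i) m ≠ 0 ∨ G.totalEffect w (Sum.inr j) m ≠ 0

/-- The disturbances that are merged with `η m` in the canonical model over `X i` and `X j`. -/
def mergeClass (G : CausalGraph L O) (w : G.Edge → ℝ) (i j : O) (m : L ⊕ O) : Set (L ⊕ O) :=
  {m' | G.Occurs w i j m' ∧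
    G.totalEffect w (Sum.inr i) m * G.totalEffect w (Sum.inr j) m' =
      G.totalEffect w (Sum.inr i) m' * G.totalEffect w (Sum.inr j) m}

/-- `Conf(X i, X j)`: the latent confounders in the canonical model over `X i` and `X j`, each
given by the set of disturbances merged into it. -/
def conf (G : CausalGraph L O) (w : G.Edge → ℝ) (i j : O) : Set (Set (L ⊕ O)) :=
  {s | ∃ m, G.Occurs w i j m ∧ s = G.mergeClass w i j m ∧ Sum.inr i ∉ s ∧ Sum.inr j ∉ s}

section Law

variable {Ω : Type*} [MeasurableSpace Ω]

/-- All observed variables are mutually (pairwise) dependent. -/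
def MutuallyDependent (G : CausalGraph L O) (μ : Measure Ω) (η : L ⊕ O → Ω → ℝ)
    (w : G.Edge → ℝ) : Prop :=
  ∀ x y, x ≠ y → ¬ IndepFun (G.obs w η x) (G.obs w η y) μ

/-- The Triad constraint for `{X i, X j}` and `X k`: `Cov(X j, X k) ≠ 0`, and
`X i - (Cov(X i, X k) / Cov(X j, X k)) X j` is independent of `X k`. -/
def Triad (G : CausalGraph L O) (μ : Measure Ω) (η : L ⊕ O → Ω → ℝ) (w : G.Edge → ℝ)
    (i j k : O) : Prop :=
  covariance (G.obs w η j) (G.obs w η k) μ ≠ 0 ∧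
    IndepFun
      (fun ω => G.obs w η i ω -
        covariance (G.obs w η i) (G.obs w η k) μ / covariance (G.obs w η j) (G.obs w η k) μ *
          G.obs w η j ω)
      (G.obs w η k) μ

/-- The pairs that are merged directly: either dependent and satisfying the Triad constraint with
every third observed variable, or in an ancestral relationship. -/
def MergePair (G : CausalGraph L O) (μ : Measure Ω) (η : L ⊕ O → Ω → ℝ) (w : G.Edge → ℝ)
    (i j : O) : Prop :=
  i ≠ j ∧
    ((¬ IndepFun (G.obs w η i) (G.obs w η j) μ ∧
        ∀ k, k ≠ i → k ≠ j → G.Triad μ η w i j k) ∨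
      G.ObsAnc i j ∨ G.ObsAnc j i)

/-- `X x` and `X y` lie in the same estimated cluster: overlapping clusters are merged, so the
estimated clusters are the classes of the equivalence relation generated by the merged pairs. -/
def SameCluster (G : CausalGraph L O) (μ : Measure Ω) (η : L ⊕ O → Ω → ℝ) (w : G.Edge → ℝ)
    (x y : O) : Prop :=
  Relation.EqvGen (G.MergePair μ η w) x y

/-- `oc` consists of one variable of each estimated cluster, and this variable is highest in the
causal order within its cluster. -/
structure IsRepresentatives (G : CausalGraph L O) (μ : Measure Ω) (η : L ⊕ O → Ω → ℝ)
    (w : G.Edge → ℝ) (oc : Finset O) : Prop where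
  unique_rep : ∀ x, ∃! r, r ∈ oc ∧ G.SameCluster μ η w r x
  highest : ∀ r ∈ oc, ∀ y, G.SameCluster μ η w r y → ¬ G.ObsAnc y r

/-- The companion set of `X i`: one arbitrary further element of the cluster of `X i` if
there is one, and empty otherwise. -/
def IsCompanionSet (G : CausalGraph L O) (μ : Measure Ω) (η : L ⊕ O → Ω → ℝ)
    (w : G.Edge → ℝ) (i : O) (C : Finset O) : Prop :=
  (∃ i', G.SameCluster μ η w i i' ∧ i' ≠ i ∧ C = {i'}) ∨
    ((∀ y, G.SameCluster μ η w i y → y = i) ∧ C = ∅)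

/-- The matrix `A^(1)_(Y → Z)`, with rows `c_{Y,Y,·,·}` of order `3`, and `c_{Y,Y,·,·}` and
`c_{Z,Y,·,·}` of order `4`; the column `t` replaces the last `t` indices `Y` by `Z`. -/
noncomputable def cumulantMatrix (μ : Measure Ω) (Y Z : Ω → ℝ) : Matrix (Fin 3) (Fin 3) ℝ :=
  Matrix.of ![fun t => pairCumulant μ Y Z (3 - t.val) t.val,
    fun t => pairCumulant μ Y Z (4 - t.val) t.val,
    fun t => pairCumulant μ Y Z (3 - t.val) (t.val + 1)]

/-- The minor, with the rows `r 0` and `r 1` of the cumulant matrix below the first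
row `(1, α, α ^ 2)`, as a function of `α`. -/
noncomputable def minorDet (μ : Measure Ω) (Y Z : Ω → ℝ) (r : Fin 2 → Fin 3) (α : ℝ) : ℝ :=
  (Matrix.of ![![1, α, α ^ 2], cumulantMatrix μ Y Z (r 0), cumulantMatrix μ Y Z (r 1)]).det

/-- For a pair with a single latent confounder: `c` is the estimated `k`-th cumulant
`c^(k)_(X i → X j)` of that confounder. The roots of the minor are the total effect `α₀` of `X i`
on `X j` and a second number `α₁ ≠ α₀`, and `(c₀, c)` solves the Vandermonde system
`α₀ ^ m * c₀ + α₁ ^ m * c = c_{i,…,i,j,…,j}` (with `m` indices `j`), `m = 0, …, k - 1`. There is at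
most one such `c` when `2 ≤ k`. -/
def IsEstimatedCumulant (G : CausalGraph L O) (μ : Measure Ω) (η : L ⊕ O → Ω → ℝ)
    (w : G.Edge → ℝ) (r : Fin 2 → Fin 3) (k : ℕ) (i j : O) (c : ℝ) : Prop :=
  ∃ α₁ c₀ : ℝ, α₁ ≠ G.totalEffect w (Sum.inr j) (Sum.inr i) ∧
    {α | minorDet μ (G.obs w η i) (G.obs w η j) r α = 0} =
      {G.totalEffect w (Sum.inr j) (Sum.inr i), α₁} ∧
    ∀ m < k, G.totalEffect w (Sum.inr j) (Sum.inr i) ^ m * c₀ + α₁ ^ m * c =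
      pairCumulant μ (G.obs w η i) (G.obs w η j) (k - m) m

end Law

end CausalGraph

section Cumulants

open Finset Polynomial

/-! ### Partitions, colourings and falling factorials -/

/-! Cumulants are multilinear and vanish across independent groups, so a joint cumulant of linear
combinations of the disturbances is a sum over single disturbances of a product of coefficients
times its own cumulant (`jointCumulant_linearCombination`). The vanishing is seen by counting
colourings: the cumulant is the derivative at 0 of a polynomial whose value at q sums over
q-colourings, and independence factors that polynomial into two that both vanish at 0.

Let X_j not be an ancestor of X_i. The disturbances occurring in X_i either act on X_j in the ratio
α₀ = α_{ji}, or are confounding. If all confounding ones have the same ratio α₁, every joint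
cumulant of order n containing X_i at least once is α₀^b p_n + α₁^b q_n, with b the number of
indices j, and p_n, q_n the own and the confounding part of the n-th cumulant of X_i. The minor is
then a 2×2 determinant in the p's and q's times a Vandermonde determinant (`minorDet_eq`), and the
estimated cumulant is q_k.

If L_i is a source, X_i contains only its own disturbance and that of L_i. Pairwise dependence puts
L_i above every latent variable, so L_i alone confounds each pair, and q_k = λ^k κ_k(L_i), with λ
the effect of L_i on X_i, does not depend on j. Generic nonvanishing of the 2×2 determinants makes
the two roots available for every minor.

If L_i is not a source, take a source s above it. The pair of X_i with a representative below s is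
confounded by s alone, whereas a second child of L_i leads to a variable whose pair with X_i is
confounded by the disturbance of L_i. A common estimated cumulant would equate the term of s with a
sum containing the term of L_i, which generically fails (`generically_sum_pow_ne`). In case 1 both
variables would be the single other representative, although their latent parents differ.

Estimated clusters matter only through one fact: generically their members share a latent parent
(`MergePair.parent_eq`). Each genericity condition says that two polynomials in the coefficients
differ, so one explicit coefficient vector suffices for each. -/

theorem Finpartition.parts_eq_image_part {ι : Type*} [Fintype ι] [DecidableEq ι]
    (π : Finpartition (univ : Finset ι)) : π.parts = univ.image π.part := by
  ext I
  simp only [mem_image, mem_univ, true_and]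
  constructor
  · intro hI
    obtain ⟨t, ht⟩ := π.nonempty_of_mem_parts hI
    exact ⟨t, π.part_eq_of_mem hI ht⟩
  · rintro ⟨t, rfl⟩
    exact π.part_mem.2 (mem_univ t)

theorem Finpartition.ext_part {ι : Type*} [Fintype ι] [DecidableEq ι]
    {π ρ : Finpartition (univ : Finset ι)} (h : ∀ t, π.part t = ρ.part t) : π = ρ := by
  ext1
  rw [π.parts_eq_image_part, ρ.parts_eq_image_part, funext h]

/-- The partition of the index set into the fibres of `g`. -/
def fiberPartition {ι γ : Type*} [Fintype ι] [DecidableEq ι] [DecidableEq γ] (g : ι → γ) :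
    Finpartition (univ : Finset ι) :=
  letI : DecidableRel (Setoid.ker g).r := fun a b => decEq (g a) (g b)
  Finpartition.ofSetoid (Setoid.ker g)

theorem mem_part_fiberPartition {ι γ : Type*} [Fintype ι] [DecidableEq ι] [DecidableEq γ]
    (g : ι → γ) (a b : ι) : b ∈ (fiberPartition g).part a ↔ g a = g b := by
  unfold fiberPartition
  rw [Finpartition.mem_part_ofSetoid_iff_rel]
  exact Iff.rfl

theorem part_fiberPartition {ι γ : Type*} [Fintype ι] [DecidableEq ι] [DecidableEq γ]
    (g : ι → γ) (a : ι) : (fiberPartition g).part a = univ.filter (g · = g a) := by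
  ext b
  rw [mem_part_fiberPartition]
  simp [eq_comm]

/-- Unused colours contribute `m ∅ = 1`, so only the nonempty fibres, the blocks, remain. -/
theorem prod_fibers_eq_prod_parts {ι γ M : Type*} [CommMonoid M] [Fintype ι] [DecidableEq ι]
    [Fintype γ] [DecidableEq γ] (m : Finset ι → M) (hm : m ∅ = 1) (g : ι → γ) :
    ∏ c, m (univ.filter (g · = c)) = ∏ I ∈ (fiberPartition g).parts, m I := by
  have h1 : (fiberPartition g).parts = (univ.image g).image fun c => univ.filter (g · = c) := by
    rw [Finpartition.parts_eq_image_part, image_image]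
    exact image_congr fun a _ => part_fiberPartition g a
  rw [h1, prod_image]
  · symm
    apply prod_subset (subset_univ _)
    intro c _ hc
    rw [← hm]
    congr 1
    ext t
    simp only [mem_filter, mem_univ, true_and, notMem_empty, iff_false]
    rintro rfl
    exact hc (mem_image_of_mem g (mem_univ t))
  · intro c hc d _ hcd
    obtain ⟨t, -, rfl⟩ := mem_image.1 hc
    have : t ∈ univ.filter (g · = g t) := by simp
    have hcd' : univ.filter (g · = g t) = univ.filter (g · = d) := hcd
    rw [hcd'] at this
    simpa using this

/-- A colouring with prescribed fibres is an injective assignment of colours to the blocks. -/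
theorem card_fiberPartition_eq {ι γ : Type*} [Fintype ι] [DecidableEq ι]
    [Fintype γ] [DecidableEq γ] (π : Finpartition (univ : Finset ι)) :
    (univ.filter fun g : ι → γ => fiberPartition g = π).card =
      (Fintype.card γ).descFactorial π.parts.card := by
  have hmem : ∀ t, π.part t ∈ π.parts := fun t => π.part_mem.2 (mem_univ t)
  rw [← Fintype.card_coe π.parts, ← Fintype.card_embedding_eq, ← card_univ]
  symm
  refine card_bij (fun (e : π.parts ↪ γ) _ t => e ⟨π.part t, hmem t⟩) ?_ ?_ ?_
  · intro e _
    simp only [mem_filter, mem_univ, true_and]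
    apply Finpartition.ext_part
    intro t
    ext b
    rw [mem_part_fiberPartition, π.mem_part_iff_part_eq_part (mem_univ b) (mem_univ t)]
    simp [eq_comm]
  · intro e _ e' _ h
    ext ⟨I, hI⟩
    obtain ⟨t, ht⟩ := π.nonempty_of_mem_parts hI
    have := congrFun h t
    simpa [π.part_eq_of_mem hI ht] using this
  · intro g hg
    simp only [mem_filter, mem_univ, true_and] at hg
    subst hg
    choose s hs using fun I : (fiberPartition g).parts =>
      (fiberPartition g).nonempty_of_mem_parts I.2
    refine ⟨⟨fun I => g (s I), ?_⟩, mem_univ _, ?_⟩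
    · intro I J hIJ
      have h1 : s J ∈ (fiberPartition g).part (s I) := by
        rw [mem_part_fiberPartition]; exact hIJ
      rw [(fiberPartition g).part_eq_of_mem I.2 (hs I)] at h1
      exact Subtype.ext ((fiberPartition g).eq_of_mem_parts I.2 J.2 h1 (hs J))
    · funext t
      have h1 := hs ⟨(fiberPartition g).part t, hmem t⟩
      rw [mem_part_fiberPartition] at h1
      exact h1.symm

/-- The sum over the colourings with `q` colours of the products of `m` over the colour classes is
this polynomial evaluated at `q`. -/
noncomputable def coloringPolynomial {ι : Type*} [Fintype ι] [DecidableEq ι]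
    (m : Finset ι → ℝ) : ℝ[X] :=
  ∑ π : Finpartition (univ : Finset ι),
    C (∏ I ∈ π.parts, m I) * descPochhammer ℝ π.parts.card

theorem eval_coloringPolynomial {ι : Type*} [Fintype ι] [DecidableEq ι]
    (m : Finset ι → ℝ) (hm : m ∅ = 1) (q : ℕ) :
    (coloringPolynomial m).eval (q : ℝ) =
      ∑ g : ι → Fin q, ∏ c, m (univ.filter (g · = c)) := by
  rw [← sum_fiberwise univ (fun g : ι → Fin q => fiberPartition g), coloringPolynomial,
    eval_finsetSum]
  refine sum_congr rfl fun π _ => ?_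
  rw [sum_congr rfl (g := fun _ => ∏ I ∈ π.parts, m I)]
  · rw [sum_const, card_fiberPartition_eq, Fintype.card_fin, eval_mul, eval_C,
      descPochhammer_eval_eq_descFactorial, nsmul_eq_mul, mul_comm]
  · intro g hg
    rw [prod_fibers_eq_prod_parts m hm, (mem_filter.1 hg).2]

/-- 0 is a simple root of x(x - 1)⋯(x - n + 1), and the other factors at 0 multiply to the partition
weight in the definition of a cumulant. -/
theorem eval_derivative_descPochhammer_zero (n : ℕ) (hn : n ≠ 0) :
    (derivative (descPochhammer ℝ n)).eval 0 = (-1) ^ (n - 1) * ((n - 1).factorial : ℝ) := by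
  induction n with
  | zero => exact absurd rfl hn
  | succ n ih =>
    rw [descPochhammer_succ_right, derivative_mul, eval_add, eval_mul, eval_mul]
    rcases Nat.eq_zero_or_pos n with rfl | h
    · simp
    · rw [ih h.ne', descPochhammer_ne_zero_eval_zero ℝ h.ne']
      obtain ⟨k, rfl⟩ : ∃ k, n = k + 1 := ⟨n - 1, by omega⟩
      simp [Nat.factorial_succ, pow_succ]
      ring

/-- This turns the cumulant formula into a linear coefficient, to which the product rule applies. -/
theorem eval_derivative_coloringPolynomial_zero {ι : Type*} [Fintype ι] [DecidableEq ι]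
    [Nonempty ι] (m : Finset ι → ℝ) :
    (derivative (coloringPolynomial m)).eval 0 =
      ∑ π : Finpartition (univ : Finset ι), (-1 : ℝ) ^ (π.parts.card - 1) *
        ((π.parts.card - 1).factorial : ℝ) * ∏ I ∈ π.parts, m I := by
  rw [coloringPolynomial, derivative_sum, eval_finsetSum]
  refine sum_congr rfl fun π _ => ?_
  have h : π.parts.card ≠ 0 := by
    rw [Finset.card_ne_zero]
    exact π.parts_nonempty (by simpa using univ_nonempty.ne_empty)
  rw [derivative_C_mul, eval_mul, eval_C, eval_derivative_descPochhammer_zero _ h, mul_comm]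

theorem coloringPolynomial_eval_zero {ι : Type*} [Fintype ι] [DecidableEq ι] [Nonempty ι]
    (m : Finset ι → ℝ) (hm : m ∅ = 1) : (coloringPolynomial m).eval 0 = 0 := by
  have h := eval_coloringPolynomial m hm 0
  rw [Nat.cast_zero] at h
  rw [h]
  have : IsEmpty (ι → Fin 0) := ⟨fun g => (g (Classical.arbitrary ι)).elim0⟩
  exact Fintype.sum_empty _

/-- A multiplicative set function has a vanishing signed sum over partitions. -/
theorem sum_finpartition_eq_zero_of_factor {ι : Type*} [Fintype ι] [DecidableEq ι]
    (m : Finset ι → ℝ) (hm : m ∅ = 1) (p : ι → Prop) [DecidablePred p]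
    (hp : ∃ t, p t) (hp' : ∃ t, ¬ p t)
    (hfac : ∀ I, m I = m (I.filter p) * m (I.filter fun t => ¬ p t)) :
    ∑ π : Finpartition (univ : Finset ι), (-1 : ℝ) ^ (π.parts.card - 1) *
        ((π.parts.card - 1).factorial : ℝ) * ∏ I ∈ π.parts, m I = 0 := by
  obtain ⟨t₀, ht₀⟩ := hp
  obtain ⟨t₁, ht₁⟩ := hp'
  have : Nonempty ι := ⟨t₀⟩
  have : Nonempty {t // p t} := ⟨⟨t₀, ht₀⟩⟩
  have : Nonempty {t // ¬ p t} := ⟨⟨t₁, ht₁⟩⟩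
  set m₁ : Finset {t // p t} → ℝ := fun I => m (I.map (Function.Embedding.subtype _)) with hm₁
  set m₂ : Finset {t // ¬ p t} → ℝ := fun I => m (I.map (Function.Embedding.subtype _)) with hm₂
  have e₁ : m₁ ∅ = 1 := by simp [hm₁, hm]
  have e₂ : m₂ ∅ = 1 := by simp [hm₂, hm]
  -- At a natural number q, a colouring is a pair of independent colourings of the two halves.
  -- Agreement at all q gives equality of polynomials.
  have key : coloringPolynomial m = coloringPolynomial m₁ * coloringPolynomial m₂ := by
    apply Polynomial.eq_of_infinite_eval_eq
    refine Set.Infinite.mono ?_ (Set.infinite_range_of_injective (Nat.cast_injective (R := ℝ)))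
    rintro _ ⟨q, rfl⟩
    simp only [Set.mem_ofPred_eq, eval_mul]
    rw [eval_coloringPolynomial m hm, eval_coloringPolynomial m₁ e₁,
      eval_coloringPolynomial m₂ e₂, sum_mul_sum, ← sum_product']
    refine Fintype.sum_equiv (Equiv.piEquivPiSubtypeProd p fun _ => Fin q) _ _ fun g => ?_
    simp only [Equiv.piEquivPiSubtypeProd_apply]
    rw [← prod_mul_distrib]
    refine prod_congr rfl fun c _ => ?_
    rw [hfac]
    congr 2 <;>
    · ext t
      simp [and_comm]
  -- In the product rule each summand keeps one undifferentiated factor, which vanishes at 0.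
  rw [← eval_derivative_coloringPolynomial_zero, key, derivative_mul, eval_add, eval_mul, eval_mul,
    coloringPolynomial_eval_zero m₁ e₁, coloringPolynomial_eval_zero m₂ e₂]
  simp

/-! ### Cumulants of independent variables -/

variable {Ω : Type*} [MeasurableSpace Ω] {μ : Measure Ω}

/-- A joint cumulant vanishes if its arguments split into two independent groups. -/
theorem jointCumulant_eq_zero_of_indepFun [IsProbabilityMeasure μ] {α β : Type*}
    [MeasurableSpace α] [MeasurableSpace β] {k : ℕ} {Y : Fin k → Ω → ℝ} {U : Ω → α} {W : Ω → β}
    (hU : Measurable U) (hW : Measurable W)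
    (hUW : IndepFun U W μ) (p : Fin k → Prop) (hp : ∃ t, p t) (hp' : ∃ t, ¬ p t)
    (h1 : ∀ t, p t → ∃ φ : α → ℝ, Measurable φ ∧ Y t = φ ∘ U)
    (h2 : ∀ t, ¬ p t → ∃ φ : β → ℝ, Measurable φ ∧ Y t = φ ∘ W) :
    jointCumulant μ Y = 0 := by
  classical
  refine sum_finpartition_eq_zero_of_factor (fun I => ∫ ω, ∏ t ∈ I, Y t ω ∂μ) (by simp) p hp hp' ?_
  intro I
  choose φ hφ hYφ using h1
  choose ψ hψ hYψ using h2
  set F : α → ℝ := fun a => ∏ t ∈ I, if h : p t then φ t h a else 1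
  set G : β → ℝ := fun b => ∏ t ∈ I, if h : p t then 1 else ψ t h b
  have hF : Measurable F := by
    refine Finset.measurable_fun_prod _ fun t _ => ?_
    by_cases h : p t
    · simpa [h] using hφ t h
    · simp [h]
  have hG : Measurable G := by
    refine Finset.measurable_fun_prod _ fun t _ => ?_
    by_cases h : p t
    · simp [h]
    · simpa [h] using hψ t h
  have hFe : ∀ ω, ∏ t ∈ I.filter p, Y t ω = F (U ω) := by
    intro ω
    rw [prod_filter]
    refine prod_congr rfl fun t _ => ?_
    by_cases h : p t
    · simp [h, hYφ t h]
    · simp [h]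
  have hGe : ∀ ω, ∏ t ∈ I.filter (fun t => ¬ p t), Y t ω = G (W ω) := by
    intro ω
    rw [prod_filter]
    refine prod_congr rfl fun t _ => ?_
    by_cases h : p t
    · simp [h]
    · simp [h, hYψ t h]
  simp only [hFe, hGe]
  have hsplit : ∀ ω, ∏ t ∈ I, Y t ω = F (U ω) * G (W ω) := by
    intro ω
    rw [← hFe, ← hGe, prod_filter_mul_prod_filter_not]
  simp only [hsplit]
  exact (hUW.comp hF hG).integral_fun_mul_eq_mul_integral
    (hF.comp hU).aestronglyMeasurable (hG.comp hW).aestronglyMeasurable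

/-! ### Finite moments and multilinearity of cumulants -/

theorem memLp_nat_mul {f g : Ω → ℝ} (hf : ∀ n : ℕ, MemLp f n μ) (hg : ∀ n : ℕ, MemLp g n μ)
    (n : ℕ) : MemLp (fun ω => f ω * g ω) n μ := by
  have : ENNReal.HolderTriple ((2 * n : ℕ) : ENNReal) ((2 * n : ℕ) : ENNReal) (n : ENNReal) := by
    refine ⟨?_⟩
    rw [← two_mul, Nat.cast_mul, ENNReal.mul_inv (by simp) (by simp), ← mul_assoc]
    simp [ENNReal.mul_inv_cancel]
  exact (hg (2 * n)).mul (hf (2 * n))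

theorem memLp_nat_prod [IsProbabilityMeasure μ] {ι : Type*} (s : Finset ι) {f : ι → Ω → ℝ}
    (hf : ∀ i (n : ℕ), MemLp (f i) n μ) (n : ℕ) : MemLp (fun ω => ∏ i ∈ s, f i ω) n μ := by
  classical
  induction s using Finset.induction_on generalizing n with
  | empty => simpa using memLp_const (1 : ℝ)
  | insert a s ha ih =>
    simp only [prod_insert ha]
    exact memLp_nat_mul (hf a) ih n

variable (μ) in
/-- The random variables with finite moments of all orders. -/
def allMoments : Submodule ℝ (Ω → ℝ) where
  carrier := {Y | ∀ n : ℕ, MemLp Y n μ}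
  add_mem' ha hb n := (ha n).add (hb n)
  zero_mem' _ := MemLp.zero
  smul_mem' c _ hf n := (hf n).const_smul c

/-- Only the block of `t` sees the updated argument, which makes each partition term linear in it.
-/
theorem prod_integral_update {k : ℕ} [DecidableEq (Fin k)]
    (π : Finpartition (univ : Finset (Fin k)))
    (Y : Fin k → Ω → ℝ) (t : Fin k) (x : Ω → ℝ) :
    ∏ I ∈ π.parts, ∫ ω, ∏ s ∈ I, Function.update Y t x s ω ∂μ =
      (∫ ω, x ω * ∏ s ∈ (π.part t).erase t, Y s ω ∂μ) *
        ∏ I ∈ π.parts.erase (π.part t), ∫ ω, ∏ s ∈ I, Y s ω ∂μ := by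
  have ht : t ∈ π.part t := π.mem_part_self.2 (mem_univ t)
  have hp : π.part t ∈ π.parts := π.part_mem.2 (mem_univ t)
  rw [← mul_prod_erase _ _ hp]
  congr 1
  · congr 1
    funext ω
    rw [← mul_prod_erase _ _ ht]
    simp only [Function.update_self]
    congr 1
    refine prod_congr rfl fun s hs => ?_
    rw [Function.update_of_ne (ne_of_mem_erase hs)]
  · refine prod_congr rfl fun I hI => ?_
    congr 1
    funext ω
    refine prod_congr rfl fun s hs => ?_
    rw [Function.update_of_ne]
    rintro rfl
    exact ne_of_mem_erase hI (π.part_eq_of_mem (mem_of_mem_erase hI) hs).symm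

variable (μ) in
/-- The joint cumulant as a multilinear map. -/
noncomputable def jointCumulantMap [IsProbabilityMeasure μ] (k : ℕ) :
    MultilinearMap ℝ (fun _ : Fin k => allMoments μ) ℝ where
  toFun Y := jointCumulant μ fun t => (Y t : Ω → ℝ)
  map_update_add' := by
    intro inst Y t x y
    have hcoe : ∀ z : allMoments μ, (fun s => (Function.update Y t z s : Ω → ℝ)) =
        Function.update (fun s => (Y s : Ω → ℝ)) t (z : Ω → ℝ) := by
      intro z
      funext s
      by_cases h : s = t
      · subst h; simp
      · simp [h]
    obtain rfl : inst = instDecidableEqFin k := Subsingleton.elim _ _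
    change jointCumulant μ (fun s => (Function.update Y t (x + y) s : Ω → ℝ)) =
      jointCumulant μ (fun s => (Function.update Y t x s : Ω → ℝ)) +
      jointCumulant μ (fun s => (Function.update Y t y s : Ω → ℝ))
    rw [hcoe, hcoe, hcoe]
    simp only [jointCumulant, prod_integral_update]
    rw [← sum_add_distrib]
    refine sum_congr rfl fun π _ => ?_
    have hint : ∀ z : allMoments μ, Integrable
        (fun ω => (z : Ω → ℝ) ω * ∏ s ∈ (π.part t).erase t, (Y s : Ω → ℝ) ω) μ := by
      intro z
      exact memLp_one_iff_integrable.1 (by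
        exact_mod_cast memLp_nat_mul z.2 (memLp_nat_prod _ fun s => (Y s).2) 1)
    have hadd := integral_add (hint x) (hint y)
    rw [← mul_add, ← add_mul, ← hadd]
    simp only [Submodule.coe_add, Pi.add_apply, add_mul]
  map_update_smul' := by
    intro inst Y t c x
    have hcoe : ∀ z : allMoments μ, (fun s => (Function.update Y t z s : Ω → ℝ)) =
        Function.update (fun s => (Y s : Ω → ℝ)) t (z : Ω → ℝ) := by
      intro z
      funext s
      by_cases h : s = t
      · subst h; simp
      · simp [h]
    obtain rfl : inst = instDecidableEqFin k := Subsingleton.elim _ _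
    change jointCumulant μ (fun s => (Function.update Y t (c • x) s : Ω → ℝ)) =
      c • jointCumulant μ (fun s => (Function.update Y t x s : Ω → ℝ))
    rw [hcoe, hcoe]
    simp only [jointCumulant, prod_integral_update]
    rw [smul_eq_mul, mul_sum]
    refine sum_congr rfl fun π _ => ?_
    simp only [Submodule.coe_smul, Pi.smul_apply, smul_eq_mul, mul_assoc]
    rw [integral_const_mul]
    ring

theorem jointCumulantMap_apply [IsProbabilityMeasure μ] {k : ℕ} (Y : Fin k → allMoments μ) :
    jointCumulantMap μ k Y = jointCumulant μ fun t => (Y t : Ω → ℝ) :=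
  rfl

/-- Cumulants of linear combinations of independent variables. -/
theorem jointCumulant_linearCombination [IsProbabilityMeasure μ] {V : Type*} [Fintype V]
    {η : V → Ω → ℝ} (hmeas : ∀ v, Measurable (η v)) (hind : iIndepFun η μ)
    (hmom : ∀ v (n : ℕ), MemLp (η v) n μ) {k : ℕ} (hk : k ≠ 0) (M : Fin k → V → ℝ) :
    jointCumulant μ (fun t ω => ∑ u, M t u * η u ω) =
      ∑ u, (∏ t, M t u) * jointCumulant μ (fun _ : Fin k => η u) := by
  classical
  set E : V → allMoments μ := fun u => ⟨η u, hmom u⟩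
  have h1 : jointCumulant μ (fun t ω => ∑ u, M t u * η u ω) =
      jointCumulantMap μ k (fun t => ∑ u, M t u • E u) := by
    rw [jointCumulantMap_apply]
    congr 1
    funext t ω
    simp [E, Finset.sum_apply]
  rw [h1, MultilinearMap.map_sum]
  simp only [MultilinearMap.map_smul_univ, smul_eq_mul]
  have : NeZero k := ⟨hk⟩
  have hinj : Function.Injective (fun (u : V) (_ : Fin k) => u) :=
    fun u v h => congrFun h 0
  rw [← sum_subset (subset_univ (univ.image fun (u : V) (_ : Fin k) => u))]
  · rw [sum_image fun u _ v _ h => hinj h]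
    rfl
  -- For a nonconstant choice of disturbances, the positions carrying `ρ 0` are independent of the
  -- others, so the term vanishes.
  · intro ρ _ hρ
    have hne : ∃ t, ρ t ≠ ρ 0 := by
      by_contra! hcon
      exact hρ (mem_image.2 ⟨ρ 0, mem_univ _, funext fun t => (hcon t).symm⟩)
    have hz : jointCumulant μ (fun t => η (ρ t)) = 0 := by
      have hdis : Disjoint ({ρ 0} : Finset V) (univ.erase (ρ 0)) := by simp
      refine jointCumulant_eq_zero_of_indepFun
        (U := fun ω (v : ({ρ 0} : Finset V)) => η v ω)
        (W := fun ω (v : (univ.erase (ρ 0) : Finset V)) => η v ω)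
        (measurable_pi_lambda _ fun v => hmeas v)
        (measurable_pi_lambda _ fun v => hmeas v)
        (hind.indepFun_finset _ _ hdis hmeas) (fun t => ρ t = ρ 0) ⟨0, rfl⟩ hne ?_ ?_
      · intro t ht
        exact ⟨fun a => a ⟨ρ t, by simp [ht]⟩, measurable_pi_apply _, rfl⟩
      · intro t ht
        exact ⟨fun a => a ⟨ρ t, by simpa using ht⟩, measurable_pi_apply _, rfl⟩
    change _ * jointCumulant μ (fun t => η (ρ t)) = 0
    rw [hz, mul_zero]

theorem pairCumulant_linearCombination [IsProbabilityMeasure μ] {V : Type*} [Fintype V]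
    {η : V → Ω → ℝ} (hmeas : ∀ v, Measurable (η v)) (hind : iIndepFun η μ)
    (hmom : ∀ v (n : ℕ), MemLp (η v) n μ) {a b : ℕ} (hab : a + b ≠ 0) (y z : V → ℝ) :
    pairCumulant μ (fun ω => ∑ u, y u * η u ω) (fun ω => ∑ u, z u * η u ω) a b =
      ∑ u, y u ^ a * z u ^ b * jointCumulant μ (fun _ : Fin (a + b) => η u) := by
  have h1 : (fun t : Fin (a + b) => if t.val < a then (fun ω => ∑ u, y u * η u ω)
      else (fun ω => ∑ u, z u * η u ω)) =
      fun (t : Fin (a + b)) ω => ∑ u, (if t.val < a then y u else z u) * η u ω := by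
    funext t ω
    split_ifs <;> rfl
  rw [pairCumulant, h1, jointCumulant_linearCombination hmeas hind hmom hab
    fun t u => if t.val < a then y u else z u]
  refine sum_congr rfl fun u _ => ?_
  congr 1
  rw [Fin.prod_univ_add]
  simp

theorem pairCumulant_eq_zero_of_indepFun [IsProbabilityMeasure μ] {Y Z : Ω → ℝ}
    (hY : Measurable Y) (hZ : Measurable Z) (h : IndepFun Y Z μ) {a b : ℕ} (ha : a ≠ 0)
    (hb : b ≠ 0) : pairCumulant μ Y Z a b = 0 := by
  refine jointCumulant_eq_zero_of_indepFun hY hZ h (fun t => t.val < a)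
    ⟨⟨0, by omega⟩, by simp; omega⟩ ⟨⟨a, by omega⟩, by simp⟩ ?_ ?_
  · intro t ht
    exact ⟨id, measurable_id, by simp [ht]⟩
  · intro t ht
    exact ⟨id, measurable_id, by simp [ht]⟩

/-- Linear combinations of independent variables with disjoint supports are independent. -/
theorem indepFun_linearCombination {V : Type*} [Fintype V]
    {η : V → Ω → ℝ} (hmeas : ∀ v, Measurable (η v)) (hind : iIndepFun η μ) (y z : V → ℝ)
    (h : ∀ u, y u = 0 ∨ z u = 0) :
    IndepFun (fun ω => ∑ u, y u * η u ω) (fun ω => ∑ u, z u * η u ω) μ := by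
  classical
  -- Split the disturbances by the support of `y`; by hypothesis `z` lives on the complement.
  have key := hind.indepFun_finset (univ.filter fun u => y u ≠ 0)
    (univ.filter fun u => y u = 0) (by
      rw [disjoint_filter]; intro u _ h1 h2; exact h1 h2) hmeas
  have hsum : ∀ (c : V → ℝ) (s : Finset V), (∀ u, u ∉ s → c u = 0) →
      (fun ω => ∑ u, c u * η u ω) =
        (fun a : s → ℝ => ∑ u : s, c u * a u) ∘ fun ω (u : s) => η u ω := by
    intro c s hc
    funext ω
    simp only [Function.comp]
    rw [sum_coe_sort s fun u => c u * η u ω]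
    exact (sum_subset (subset_univ s) fun u _ hu => by rw [hc u hu, zero_mul]).symm
  rw [hsum y (univ.filter fun u => y u ≠ 0) (by simp),
    hsum z (univ.filter fun u => y u = 0) fun u hu => (h u).resolve_left (by simpa using hu)]
  refine key.comp ?_ ?_ <;>
  exact Finset.measurable_fun_sum _ fun u _ => (measurable_pi_apply u).const_mul _

theorem covariance_linearCombination [IsProbabilityMeasure μ] {V : Type*} [Fintype V]
    {η : V → Ω → ℝ} (hind : iIndepFun η μ)
    (hmom : ∀ v (n : ℕ), MemLp (η v) n μ) (y z : V → ℝ) :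
    covariance (fun ω => ∑ u, y u * η u ω) (fun ω => ∑ u, z u * η u ω) μ =
      ∑ u, y u * z u * variance (η u) μ := by
  classical
  have h2 : ∀ v, MemLp (η v) 2 μ := fun v => by exact_mod_cast hmom v 2
  rw [covariance_fun_sum_fun_sum (fun u => (h2 u).const_mul _) fun u => (h2 u).const_mul _]
  refine sum_congr rfl fun u _ => ?_
  rw [sum_eq_single u]
  · rw [covariance_const_mul_left, covariance_const_mul_right,
      covariance_self (h2 u).aestronglyMeasurable.aemeasurable]
    ring
  · intro v _ hv
    rw [covariance_const_mul_left, covariance_const_mul_right,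
      (hind.indepFun hv.symm).covariance_eq_zero (h2 u) (h2 v)]
    simp
  · simp

/-- Zero variance would make the mean an atom of the law. -/
theorem variance_pos_of_continuous_law [IsProbabilityMeasure μ] {Y : Ω → ℝ}
    (hY : Measurable Y) (h2 : MemLp Y 2 μ)
    (hc : ∀ x : ℝ, μ.map Y {x} = 0) : 0 < variance Y μ := by
  refine lt_of_le_of_ne (variance_nonneg _ _) fun h0 => ?_
  have hae := ae_eq_integral_of_variance_eq_zero h2 h0.symm
  have h := hc (∫ ω, Y ω ∂μ)
  rw [Measure.map_apply hY (measurableSet_singleton _)] at h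
  have hone : μ (Y ⁻¹' {∫ ω, Y ω ∂μ}) = 1 := by
    rw [prob_compl_eq_zero_iff (hY (measurableSet_singleton _)) |>.symm]
    exact ae_iff.1 hae
  rw [hone] at h
  exact one_ne_zero h

end Cumulants

section GenericParameters

/-! ### Polynomial functions and generic properties -/

/-- `f` is a polynomial function of the coordinates. -/
def IsPolynomialFun {σ : Type*} (f : (σ → ℝ) → ℝ) : Prop :=
  ∃ P : MvPolynomial σ ℝ, ∀ w, MvPolynomial.eval w P = f w

/-- `Q` holds outside the zero set of a nonzero polynomial. -/
def Generically {σ : Type*} (Q : (σ → ℝ) → Prop) : Prop :=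
  ∃ P : MvPolynomial σ ℝ, P ≠ 0 ∧ ∀ w, MvPolynomial.eval w P ≠ 0 → Q w

variable {σ : Type*}

namespace IsPolynomialFun

theorem const (c : ℝ) : IsPolynomialFun fun _ : σ → ℝ => c :=
  ⟨MvPolynomial.C c, fun w => by simp⟩

theorem coord (e : σ) : IsPolynomialFun fun w : σ → ℝ => w e :=
  ⟨MvPolynomial.X e, fun w => by simp⟩

theorem add {f g : (σ → ℝ) → ℝ} (hf : IsPolynomialFun f) (hg : IsPolynomialFun g) :
    IsPolynomialFun fun w => f w + g w := by
  obtain ⟨P, hP⟩ := hf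
  obtain ⟨Q, hQ⟩ := hg
  exact ⟨P + Q, fun w => by simp [hP, hQ]⟩

theorem mul {f g : (σ → ℝ) → ℝ} (hf : IsPolynomialFun f) (hg : IsPolynomialFun g) :
    IsPolynomialFun fun w => f w * g w := by
  obtain ⟨P, hP⟩ := hf
  obtain ⟨Q, hQ⟩ := hg
  exact ⟨P * Q, fun w => by simp [hP, hQ]⟩

theorem sub {f g : (σ → ℝ) → ℝ} (hf : IsPolynomialFun f) (hg : IsPolynomialFun g) :
    IsPolynomialFun fun w => f w - g w := by
  obtain ⟨P, hP⟩ := hf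
  obtain ⟨Q, hQ⟩ := hg
  exact ⟨P - Q, fun w => by simp [hP, hQ]⟩

theorem pow {f : (σ → ℝ) → ℝ} (hf : IsPolynomialFun f) (n : ℕ) :
    IsPolynomialFun fun w => f w ^ n := by
  obtain ⟨P, hP⟩ := hf
  exact ⟨P ^ n, fun w => by simp [hP]⟩

theorem sum {ι : Type*} (s : Finset ι) {f : ι → (σ → ℝ) → ℝ}
    (hf : ∀ i, IsPolynomialFun (f i)) : IsPolynomialFun fun w => ∑ i ∈ s, f i w := by
  choose P hP using hf
  exact ⟨∑ i ∈ s, P i, fun w => by simp [hP]⟩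

/-- Two polynomial functions that differ at one point differ generically. -/
theorem generically_ne {f g : (σ → ℝ) → ℝ} (hf : IsPolynomialFun f) (hg : IsPolynomialFun g)
    (h : ∃ w, f w ≠ g w) : Generically fun w => f w ≠ g w := by
  obtain ⟨P, hP⟩ : ∃ P : MvPolynomial σ ℝ, ∀ w, MvPolynomial.eval w P = f w - g w := hf.sub hg
  obtain ⟨w, hw⟩ := h
  refine ⟨P, ?_, fun v hv => sub_ne_zero.1 (by rwa [← hP])⟩
  rintro rfl
  exact hw (sub_eq_zero.1 (by rw [← hP, map_zero]))

end IsPolynomialFun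

namespace Generically

theorem of_forall {Q : (σ → ℝ) → Prop} (h : ∀ w, Q w) : Generically Q :=
  ⟨1, one_ne_zero, fun w _ => h w⟩

theorem and {Q R : (σ → ℝ) → Prop} (hQ : Generically Q) (hR : Generically R) :
    Generically fun w => Q w ∧ R w := by
  obtain ⟨P₁, h₁, hw₁⟩ := hQ
  obtain ⟨P₂, h₂, hw₂⟩ := hR
  refine ⟨P₁ * P₂, mul_ne_zero h₁ h₂, fun w hw => ?_⟩
  rw [map_mul] at hw
  exact ⟨hw₁ w (left_ne_zero_of_mul hw), hw₂ w (right_ne_zero_of_mul hw)⟩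

theorem forall_finite {ι : Type*} [Finite ι] {Q : ι → (σ → ℝ) → Prop}
    (h : ∀ i, Generically (Q i)) : Generically fun w => ∀ i, Q i w := by
  have := Fintype.ofFinite ι
  choose P hP hw using h
  refine ⟨∏ i, P i, Finset.prod_ne_zero_iff.2 fun i _ => hP i, fun w hne i => hw i w ?_⟩
  rw [map_prod] at hne
  exact Finset.prod_ne_zero_iff.1 hne i (Finset.mem_univ i)

theorem imp {p : Prop} {Q : (σ → ℝ) → Prop} (h : p → Generically Q) :
    Generically fun w => p → Q w := by
  by_cases hp : p
  · obtain ⟨P, hP, hw⟩ := h hp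
    exact ⟨P, hP, fun w hne _ => hw w hne⟩
  · exact of_forall fun w h => absurd h hp

end Generically

end GenericParameters

namespace CausalGraph

variable {L O : Type*}

/-! ### Total effects -/

/-- `u` is an ancestor of `v` or equal to it. -/
abbrev Reach (G : CausalGraph L O) (u v : L ⊕ O) : Prop :=
  Relation.ReflTransGen G.Adj u v

theorem Reach.antisymm {G : CausalGraph L O} {u v : L ⊕ O} (h : G.Reach u v) (h' : G.Reach v u) :
    u = v := by
  rcases Relation.reflTransGen_iff_eq_or_transGen.1 h with h | h
  · exact h.symm
  · exact absurd (h.trans_left h') (G.acyclic u)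

theorem ne_of_adj (G : CausalGraph L O) {u v : L ⊕ O} (h : G.Adj u v) : u ≠ v := by
  rintro rfl
  exact G.acyclic u (Relation.TransGen.single h)

theorem coefMatrix_of_adj (G : CausalGraph L O) (w : G.Edge → ℝ) {u v : L ⊕ O} (h : G.Adj u v) :
    G.coefMatrix w v u = w ⟨(u, v), h⟩ := by
  simp [coefMatrix, h]

theorem coefMatrix_of_not_adj (G : CausalGraph L O) (w : G.Edge → ℝ) {u v : L ⊕ O}
    (h : ¬ G.Adj u v) : G.coefMatrix w v u = 0 := by
  simp [coefMatrix, h]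

theorem adj_of_coefMatrix_ne_zero (G : CausalGraph L O) {w : G.Edge → ℝ} {u v : L ⊕ O}
    (h : G.coefMatrix w v u ≠ 0) : G.Adj u v := by
  by_contra hn
  exact h (G.coefMatrix_of_not_adj w hn)

variable [Fintype L] [Fintype O]

open Classical in
/-- The number of proper ancestors of a vertex. -/
noncomputable def depth (G : CausalGraph L O) (v : L ⊕ O) : ℕ :=
  (Finset.univ.filter fun u => Relation.TransGen G.Adj u v).card

theorem depth_lt_of_adj (G : CausalGraph L O) {u v : L ⊕ O} (h : G.Adj u v) :
    G.depth u < G.depth v := by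
  classical
  unfold depth
  apply Finset.card_lt_card
  rw [Finset.ssubset_iff_of_subset]
  · refine ⟨u, ?_, ?_⟩
    · simpa using Relation.TransGen.single h
    · simpa using G.acyclic u
  · intro x hx
    simp only [Finset.mem_filter, Finset.mem_univ, true_and] at hx ⊢
    exact hx.tail h

theorem depth_le_card (G : CausalGraph L O) (v : L ⊕ O) :
    G.depth v ≤ Fintype.card (L ⊕ O) := by
  classical
  exact Finset.card_le_univ _

-- Each edge raises `depth`, which is bounded; hence the coefficient matrix is nilpotent and its
-- inverse is a finite geometric sum.
open Classical in
theorem depth_add_le_of_pow_ne_zero (G : CausalGraph L O) (w : G.Edge → ℝ) (n : ℕ)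
    {u v : L ⊕ O} (h : (G.coefMatrix w ^ n) v u ≠ 0) : G.depth u + n ≤ G.depth v := by
  induction n generalizing v with
  | zero =>
    rw [pow_zero, Matrix.one_apply] at h
    have : v = u := by by_contra hne; simp [hne] at h
    simp [this]
  | succ n ih =>
    rw [pow_succ', Matrix.mul_apply] at h
    obtain ⟨x, -, hx⟩ := Finset.exists_ne_zero_of_sum_ne_zero h
    have h1 := ih (right_ne_zero_of_mul hx)
    have h2 := G.depth_lt_of_adj (G.adj_of_coefMatrix_ne_zero (left_ne_zero_of_mul hx))
    omega

open Classical in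
theorem coefMatrix_pow_eq_zero (G : CausalGraph L O) (w : G.Edge → ℝ) :
    G.coefMatrix w ^ (Fintype.card (L ⊕ O) + 1) = 0 := by
  ext v u
  by_contra h
  have h1 := G.depth_add_le_of_pow_ne_zero w _ h
  have h2 := G.depth_le_card v
  omega

open Classical in
theorem totalEffect_eq_sum_pow (G : CausalGraph L O) (w : G.Edge → ℝ) :
    G.totalEffect w = ∑ n ∈ Finset.range (Fintype.card (L ⊕ O) + 1), G.coefMatrix w ^ n := by
  unfold totalEffect
  apply Matrix.inv_eq_right_inv
  rw [mul_neg_geom_sum, coefMatrix_pow_eq_zero, sub_zero]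

open Classical in
theorem totalEffect_eq_one_add_mul (G : CausalGraph L O) (w : G.Edge → ℝ) :
    G.totalEffect w = 1 + G.coefMatrix w * G.totalEffect w := by
  have h := mul_neg_geom_sum (G.coefMatrix w) (Fintype.card (L ⊕ O) + 1)
  rw [coefMatrix_pow_eq_zero, sub_zero, ← totalEffect_eq_sum_pow, sub_mul, one_mul] at h
  exact sub_eq_iff_eq_add.1 h

open Classical in
theorem eq_totalEffect (G : CausalGraph L O) (w : G.Edge → ℝ) {B : Matrix (L ⊕ O) (L ⊕ O) ℝ}
    (hB : B = 1 + G.coefMatrix w * B) : G.totalEffect w = B := by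
  unfold totalEffect
  apply Matrix.inv_eq_right_inv
  rw [sub_mul, one_mul]
  exact sub_eq_iff_eq_add.2 hB

theorem totalEffect_of_ne (G : CausalGraph L O) (w : G.Edge → ℝ) {v u : L ⊕ O} (h : v ≠ u) :
    G.totalEffect w v u = ∑ x, G.coefMatrix w v x * G.totalEffect w x u := by
  classical
  conv_lhs => rw [totalEffect_eq_one_add_mul]
  rw [Matrix.add_apply, Matrix.one_apply_ne h, zero_add, Matrix.mul_apply]

theorem reach_of_totalEffect_ne_zero (G : CausalGraph L O) {w : G.Edge → ℝ} {v u : L ⊕ O}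
    (h : G.totalEffect w v u ≠ 0) : G.Reach u v := by
  induction hd : G.depth v using Nat.strong_induction_on generalizing v with
  | _ d ih =>
    by_cases hvu : v = u
    · rw [hvu]
    · rw [G.totalEffect_of_ne w hvu] at h
      obtain ⟨x, -, hx⟩ := Finset.exists_ne_zero_of_sum_ne_zero h
      have hadj := G.adj_of_coefMatrix_ne_zero (left_ne_zero_of_mul hx)
      exact (ih _ (hd ▸ G.depth_lt_of_adj hadj) (right_ne_zero_of_mul hx) rfl).tail hadj

theorem totalEffect_eq_zero (G : CausalGraph L O) (w : G.Edge → ℝ) {v u : L ⊕ O}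
    (h : ¬ G.Reach u v) : G.totalEffect w v u = 0 := by
  by_contra hn
  exact h (G.reach_of_totalEffect_ne_zero hn)

theorem totalEffect_self (G : CausalGraph L O) (w : G.Edge → ℝ) (v : L ⊕ O) :
    G.totalEffect w v v = 1 := by
  classical
  rw [totalEffect_eq_one_add_mul, Matrix.add_apply, Matrix.one_apply_eq, Matrix.mul_apply,
    Finset.sum_eq_zero, add_zero]
  intro x _
  by_cases h : G.Adj x v
  · rw [G.totalEffect_eq_zero w fun hr => G.acyclic v (Relation.TransGen.tail' hr h), mul_zero]
  · rw [G.coefMatrix_of_not_adj w h, zero_mul]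

/-- The total effects on a vertex with a single parent factor through this parent. -/
theorem totalEffect_of_unique_parent (G : CausalGraph L O) (w : G.Edge → ℝ) {p v u : L ⊕ O}
    (hp : ∀ x, G.Adj x v → x = p) (hpv : v ≠ p) (h : v ≠ u) :
    G.totalEffect w v u = G.totalEffect w v p * G.totalEffect w p u := by
  have key : ∀ z, v ≠ z → G.totalEffect w v z = G.coefMatrix w v p * G.totalEffect w p z := by
    intro z hz
    rw [G.totalEffect_of_ne w hz]
    refine Finset.sum_eq_single p (fun x _ hx => ?_) (by simp)
    rw [G.coefMatrix_of_not_adj w fun hxv => hx (hp x hxv), zero_mul]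
  rw [key u h, key p hpv, totalEffect_self, mul_one]

theorem isPolynomialFun_totalEffect (G : CausalGraph L O) (v u : L ⊕ O) :
    IsPolynomialFun fun w : G.Edge → ℝ => G.totalEffect w v u := by
  induction hd : G.depth v using Nat.strong_induction_on generalizing v with
  | _ d ih =>
    by_cases hvu : v = u
    · subst hvu
      simp only [totalEffect_self]
      exact .const 1
    · simp only [G.totalEffect_of_ne _ hvu]
      refine .sum _ fun x => ?_
      by_cases h : G.Adj x v
      · simp only [G.coefMatrix_of_adj _ h]
        exact (IsPolynomialFun.coord _).mul (ih _ (hd ▸ G.depth_lt_of_adj h) x rfl)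
      · simp only [G.coefMatrix_of_not_adj _ h, zero_mul]
        exact .const 0

/-- With all coefficients 1, total effects count directed paths. This vector is the main witness for
genericity. -/
theorem totalEffect_one_nonneg (G : CausalGraph L O) (v u : L ⊕ O) :
    0 ≤ G.totalEffect 1 v u := by
  induction hd : G.depth v using Nat.strong_induction_on generalizing v with
  | _ d ih =>
    by_cases hvu : v = u
    · subst hvu
      simp [totalEffect_self]
    · rw [G.totalEffect_of_ne _ hvu]
      refine Finset.sum_nonneg fun x _ => ?_
      by_cases h : G.Adj x v
      · rw [G.coefMatrix_of_adj _ h, Pi.one_apply, one_mul]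
        exact ih _ (hd ▸ G.depth_lt_of_adj h) x rfl
      · rw [G.coefMatrix_of_not_adj _ h, zero_mul]

theorem totalEffect_one_pos (G : CausalGraph L O) {v u : L ⊕ O} (h : G.Reach u v) :
    0 < G.totalEffect 1 v u := by
  induction h with
  | refl => simp [totalEffect_self]
  | @tail b c hb hbc ih =>
    have hne : c ≠ u := by
      rintro rfl
      exact G.acyclic c (Relation.TransGen.tail' hb hbc)
    rw [G.totalEffect_of_ne _ hne]
    refine Finset.sum_pos' (fun x _ => ?_) ⟨b, Finset.mem_univ b, ?_⟩
    · by_cases h : G.Adj x c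
      · rw [G.coefMatrix_of_adj _ h, Pi.one_apply, one_mul]
        exact G.totalEffect_one_nonneg x u
      · rw [G.coefMatrix_of_not_adj _ h, zero_mul]
    · rw [G.coefMatrix_of_adj _ hbc, Pi.one_apply, one_mul]
      exact ih

/-- Rescaling the variables rescales the total effects. -/
theorem exists_totalEffect_rescale (G : CausalGraph L O) (w : G.Edge → ℝ) (τ : L ⊕ O → ℝ)
    (hτ : ∀ v, τ v ≠ 0) :
    ∃ w' : G.Edge → ℝ, ∀ v u, G.totalEffect w' v u = τ v * G.totalEffect w v u / τ u := by
  classical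
  refine ⟨fun e => τ e.1.2 * w e / τ e.1.1, fun v u => ?_⟩
  set w' : G.Edge → ℝ := fun e => τ e.1.2 * w e / τ e.1.1
  have hA : ∀ v u, G.coefMatrix w' v u = τ v * G.coefMatrix w v u / τ u := by
    intro v u
    by_cases h : G.Adj u v
    · rw [G.coefMatrix_of_adj _ h, G.coefMatrix_of_adj _ h]
    · rw [G.coefMatrix_of_not_adj _ h, G.coefMatrix_of_not_adj _ h]
      simp
  have hB := G.eq_totalEffect w'
    (B := Matrix.of fun v u => τ v * G.totalEffect w v u / τ u) (by
      ext v u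
      rw [Matrix.add_apply, Matrix.mul_apply]
      simp only [Matrix.of_apply, hA]
      by_cases hvu : v = u
      · subst hvu
        rw [totalEffect_self, Matrix.one_apply_eq, Finset.sum_eq_zero]
        · field_simp [hτ v]
          simp
        · intro x _
          by_cases h : G.Adj x v
          · rw [G.totalEffect_eq_zero w fun hr => G.acyclic v (Relation.TransGen.tail' hr h)]
            simp
          · rw [G.coefMatrix_of_not_adj w h]
            simp
      · rw [Matrix.one_apply_ne hvu, zero_add, G.totalEffect_of_ne w hvu, Finset.mul_sum,
          Finset.sum_div]
        refine Finset.sum_congr rfl fun x _ => ?_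
        have := hτ x
        have := hτ u
        field_simp)
  rw [hB]
  rfl

/-- Rescaling the disturbance of one vertex. -/
theorem exists_totalEffect_rescale_single (G : CausalGraph L O) (w : G.Edge → ℝ) (l : L ⊕ O)
    {c : ℝ} (hc : c ≠ 0) :
    ∃ w' : G.Edge → ℝ, (∀ v, v ≠ l → G.totalEffect w' v l = c * G.totalEffect w v l) ∧
      ∀ v u, v ≠ l → u ≠ l → G.totalEffect w' v u = G.totalEffect w v u := by
  classical
  -- Scaling variable `l` by `c⁻¹` multiplies its effects on all other vertices by `c`.
  obtain ⟨w', hw'⟩ := G.exists_totalEffect_rescale w (fun v => if v = l then c⁻¹ else 1)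
    (fun v => by split_ifs <;> simp [hc])
  refine ⟨w', fun v hv => ?_, fun v u hv hu => ?_⟩
  · rw [hw']
    simp [hv, mul_comm]
  · rw [hw']
    simp [hv, hu]

/-- With a single nonzero coefficient, the only effect is that of this edge. -/
theorem exists_totalEffect_single_edge (G : CausalGraph L O) {u₀ v₀ : L ⊕ O}
    (h : G.Adj u₀ v₀) :
    ∃ w : G.Edge → ℝ, G.totalEffect w v₀ u₀ = 1 ∧
      ∀ v u, v ≠ u → (v ≠ v₀ ∨ u ≠ u₀) → G.totalEffect w v u = 0 := by
  classical
  set w : G.Edge → ℝ := fun e => if e.1 = (u₀, v₀) then 1 else 0 with hw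
  have hA : ∀ v x, (v ≠ v₀ ∨ x ≠ u₀) → G.coefMatrix w v x = 0 := by
    intro v x hvx
    by_cases hadj : G.Adj x v
    · rw [G.coefMatrix_of_adj _ hadj, hw]
      simp only [Prod.mk.injEq, ite_eq_right_iff, one_ne_zero, imp_false]
      rintro ⟨rfl, rfl⟩
      simp at hvx
    · exact G.coefMatrix_of_not_adj _ hadj
  have h1 : ∀ v u, v ≠ u → v ≠ v₀ → G.totalEffect w v u = 0 := by
    intro v u hvu hv
    rw [G.totalEffect_of_ne w hvu]
    exact Finset.sum_eq_zero fun x _ => by rw [hA v x (Or.inl hv), zero_mul]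
  have h2 : ∀ u, v₀ ≠ u → G.totalEffect w v₀ u = G.totalEffect w u₀ u := by
    intro u hu
    rw [G.totalEffect_of_ne w hu, Finset.sum_eq_single u₀]
    · rw [G.coefMatrix_of_adj _ h]
      simp [hw]
    · intro x _ hx
      rw [hA v₀ x (Or.inr hx), zero_mul]
    · simp
  have hne := G.ne_of_adj h
  refine ⟨w, by rw [h2 _ hne.symm, totalEffect_self], fun v u hvu hor => ?_⟩
  by_cases hv : v = v₀
  · subst hv
    have hu : u ≠ u₀ := hor.resolve_left (by simp)
    rw [h2 u hvu, h1 u₀ u hu.symm hne]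
  · exact h1 v u hvu hv

/-! ### Generic properties of total effects -/

theorem generically_totalEffect_ne_zero (G : CausalGraph L O) :
    Generically fun w : G.Edge → ℝ => ∀ v u, G.Reach u v → G.totalEffect w v u ≠ 0 :=
  .forall_finite fun v => .forall_finite fun u => .imp fun h =>
    (G.isPolynomialFun_totalEffect v u).generically_ne (.const 0)
      ⟨1, (G.totalEffect_one_pos h).ne'⟩

/-- Not all of the effect along an edge `u → v` passes through `x`. It ensures that a common latent
parent really confounds its two children. -/
theorem generically_totalEffect_ne_mul (G : CausalGraph L O) :
    Generically fun w : G.Edge → ℝ => ∀ u v x, G.Adj u v → x ≠ u → x ≠ v →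
      G.totalEffect w v u ≠ G.totalEffect w x u * G.totalEffect w v x := by
  refine .forall_finite fun u => .forall_finite fun v => .forall_finite fun x => .imp fun h =>
    .imp fun hu => .imp fun hv => ?_
  refine (G.isPolynomialFun_totalEffect v u).generically_ne
    ((G.isPolynomialFun_totalEffect x u).mul (G.isPolynomialFun_totalEffect v x)) ?_
  obtain ⟨w, h1, h0⟩ := G.exists_totalEffect_single_edge h
  exact ⟨w, by rw [h1, h0 x u hu (Or.inl hv)]; simp⟩

/-- At zero coefficients the left side vanishes. This and the next condition keep the 2×2
determinants in front of the minors nonzero. -/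
theorem generically_mul_totalEffect_ne (G : CausalGraph L O) (κ₃ κ₄ : L ⊕ O → ℝ)
    (h₃ : ∀ u, κ₃ u ≠ 0) (h₄ : ∀ u, κ₄ u ≠ 0) :
    Generically fun w : G.Edge → ℝ => ∀ i s, i ≠ s →
      κ₃ i * κ₄ s * G.totalEffect w i s ≠ κ₄ i * κ₃ s := by
  refine .forall_finite fun i => .forall_finite fun s => .imp fun his => ?_
  refine ((IsPolynomialFun.const _).mul (G.isPolynomialFun_totalEffect i s)).generically_ne
    (.const _) ⟨0, ?_⟩
  rw [G.totalEffect_of_ne _ his, Finset.sum_eq_zero, mul_zero]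
  · exact (mul_ne_zero (h₄ i) (h₃ s)).symm
  · intro x _
    by_cases h : G.Adj x i
    · rw [G.coefMatrix_of_adj _ h, Pi.zero_apply, zero_mul]
    · rw [G.coefMatrix_of_not_adj _ h, zero_mul]

theorem generically_mul_totalEffect_ne_of_adj (G : CausalGraph L O) (κ₃ κ₄ : L ⊕ O → ℝ)
    (h₃ : ∀ u, κ₃ u ≠ 0) (h₄ : ∀ u, κ₄ u ≠ 0) :
    Generically fun w : G.Edge → ℝ => ∀ i j s, i ≠ j → i ≠ s → G.Adj s j →
      κ₃ i * κ₄ s * G.totalEffect w j s ≠ κ₄ i * κ₃ s * G.totalEffect w j i := by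
  refine .forall_finite fun i => .forall_finite fun j => .forall_finite fun s =>
    .imp fun hij => .imp fun his => .imp fun h => ?_
  refine ((IsPolynomialFun.const _).mul (G.isPolynomialFun_totalEffect j s)).generically_ne
    ((IsPolynomialFun.const _).mul (G.isPolynomialFun_totalEffect j i)) ?_
  obtain ⟨w, h1, h0⟩ := G.exists_totalEffect_single_edge h
  refine ⟨w, ?_⟩
  rw [h1, h0 j i hij.symm (Or.inr his), mul_zero, mul_one]
  exact mul_ne_zero (h₃ i) (h₄ s)

/-- A disturbance that occurs in `b` and `c` but not in `a` generically prevents the third-order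
cumulants from being in the same ratio as the covariances. -/
theorem generically_triad_ne (G : CausalGraph L O) (κ₂ κ₃ : L ⊕ O → ℝ)
    (h₂ : ∀ u, 0 < κ₂ u) (h₃ : ∀ u, κ₃ u ≠ 0) :
    Generically fun w : G.Edge → ℝ => ∀ a b c l, b ≠ l → c ≠ l → ¬ G.Reach l a → G.Reach l b →
      G.Reach l c → (∃ u, G.Reach u a ∧ G.Reach u c) →
      (∑ u, G.totalEffect w a u * G.totalEffect w c u ^ 2 * κ₃ u) *
        (∑ u, G.totalEffect w b u * G.totalEffect w c u * κ₂ u) ≠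
      (∑ u, G.totalEffect w b u * G.totalEffect w c u ^ 2 * κ₃ u) *
        ∑ u, G.totalEffect w a u * G.totalEffect w c u * κ₂ u := by
  classical
  refine .forall_finite fun a => .forall_finite fun b => .forall_finite fun c =>
    .forall_finite fun l => .imp fun hbl => .imp fun hcl => .imp fun hla => .imp fun hlb =>
    .imp fun hlc => .imp fun hac => ?_
  have hT := G.isPolynomialFun_totalEffect
  refine IsPolynomialFun.generically_ne
    ((IsPolynomialFun.sum _ fun u => ((hT a u).mul ((hT c u).pow 2)).mul (.const _)).mul
      (IsPolynomialFun.sum _ fun u => ((hT b u).mul (hT c u)).mul (.const _)))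
    ((IsPolynomialFun.sum _ fun u => ((hT b u).mul ((hT c u).pow 2)).mul (.const _)).mul
      (IsPolynomialFun.sum _ fun u => ((hT a u).mul (hT c u)).mul (.const _))) ?_
  have hal : a ≠ l := by rintro rfl; exact hla .refl
  -- Flipping the sign of the effects of `l` preserves the second-order sums and the sum with `a`,
  -- but changes the third-order sum of `b` and `c` by twice the term of `l`. Equality cannot hold
  -- both before and after.
  obtain ⟨w, hw, hw'⟩ := G.exists_totalEffect_rescale_single 1 l (c := -1) (by norm_num)
  have hTa : ∀ u, G.totalEffect w a u = G.totalEffect 1 a u := by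
    intro u
    by_cases hu : u = l
    · subst hu
      rw [G.totalEffect_eq_zero _ hla, G.totalEffect_eq_zero _ hla]
    · exact hw' a u hal hu
  have e1 : ∑ u, G.totalEffect w a u * G.totalEffect w c u ^ 2 * κ₃ u =
      ∑ u, G.totalEffect 1 a u * G.totalEffect 1 c u ^ 2 * κ₃ u := by
    refine Finset.sum_congr rfl fun u _ => ?_
    by_cases hu : u = l
    · subst hu
      rw [hTa, G.totalEffect_eq_zero _ hla]
      ring
    · rw [hTa, hw' c u hcl hu]
  have e2 : ∑ u, G.totalEffect w b u * G.totalEffect w c u * κ₂ u =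
      ∑ u, G.totalEffect 1 b u * G.totalEffect 1 c u * κ₂ u := by
    refine Finset.sum_congr rfl fun u _ => ?_
    by_cases hu : u = l
    · subst hu
      rw [hw b hbl, hw c hcl]
      ring
    · rw [hw' b u hbl hu, hw' c u hcl hu]
  have e3 : ∑ u, G.totalEffect w a u * G.totalEffect w c u * κ₂ u =
      ∑ u, G.totalEffect 1 a u * G.totalEffect 1 c u * κ₂ u := by
    refine Finset.sum_congr rfl fun u _ => ?_
    by_cases hu : u = l
    · subst hu
      rw [hTa, G.totalEffect_eq_zero _ hla]
      ring
    · rw [hTa, hw' c u hcl hu]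
  have e4 : ∑ u, G.totalEffect 1 b u * G.totalEffect 1 c u ^ 2 * κ₃ u -
      ∑ u, G.totalEffect w b u * G.totalEffect w c u ^ 2 * κ₃ u =
      2 * (G.totalEffect 1 b l * G.totalEffect 1 c l ^ 2 * κ₃ l) := by
    rw [← Finset.sum_sub_distrib, Finset.sum_eq_single l]
    · rw [hw b hbl, hw c hcl]
      ring
    · intro u _ hu
      rw [hw' b u hbl hu, hw' c u hcl hu, sub_self]
    · simp
  have hpos : 0 < ∑ u, G.totalEffect 1 a u * G.totalEffect 1 c u * κ₂ u := by
    obtain ⟨u, hua, huc⟩ := hac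
    refine Finset.sum_pos' (fun x _ => ?_) ⟨u, Finset.mem_univ u, ?_⟩
    · exact mul_nonneg (mul_nonneg (G.totalEffect_one_nonneg _ _) (G.totalEffect_one_nonneg _ _))
        (h₂ x).le
    · exact mul_pos (mul_pos (G.totalEffect_one_pos hua) (G.totalEffect_one_pos huc)) (h₂ u)
  have hne : G.totalEffect 1 b l * G.totalEffect 1 c l ^ 2 * κ₃ l ≠ 0 :=
    mul_ne_zero (mul_ne_zero (G.totalEffect_one_pos hlb).ne'
      (pow_ne_zero 2 (G.totalEffect_one_pos hlc).ne')) (h₃ l)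
  by_contra! hcon
  have c1 := hcon 1
  have c2 := hcon w
  rw [e1, e2, e3, c1, ← sub_eq_zero, ← sub_mul, e4] at c2
  exact mul_ne_zero (mul_ne_zero two_ne_zero hne) hpos.ne' c2

/-- Doubling the effects of `l` multiplies its term by 2^k and leaves the term of `s` unchanged. -/
theorem generically_sum_pow_ne (G : CausalGraph L O) (κ : L ⊕ O → ℝ) (hκ : ∀ u, κ u ≠ 0)
    {k : ℕ} (hk : k ≠ 0) :
    Generically fun w : G.Edge → ℝ => ∀ i l s, ∀ S : Finset (L ⊕ O), l ∈ S → i ≠ l → s ≠ l →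
      G.Reach l i →
      ∑ u ∈ S, G.totalEffect w i u ^ k * κ u ≠ G.totalEffect w i s ^ k * κ s := by
  classical
  refine .forall_finite fun i => .forall_finite fun l => .forall_finite fun s =>
    .forall_finite fun S => .imp fun hlS => .imp fun hil => .imp fun hsl => .imp fun hli => ?_
  have hT := G.isPolynomialFun_totalEffect
  refine IsPolynomialFun.generically_ne
    (IsPolynomialFun.sum _ fun u => ((hT i u).pow k).mul (.const _))
    (((hT i s).pow k).mul (.const _)) ?_
  obtain ⟨w, hw, hw'⟩ := G.exists_totalEffect_rescale_single 1 l (c := 2) (by norm_num)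
  have e : ∑ u ∈ S, G.totalEffect w i u ^ k * κ u - ∑ u ∈ S, G.totalEffect 1 i u ^ k * κ u =
      (2 ^ k - 1) * (G.totalEffect 1 i l ^ k * κ l) := by
    rw [← Finset.sum_sub_distrib, Finset.sum_eq_single l]
    · rw [hw i hil, mul_pow]
      ring
    · intro u _ hu
      rw [hw' i u hil hu, sub_self]
    · exact fun h => absurd hlS h
  by_contra! hcon
  rw [hcon w, hcon 1, hw' i s hil hsl, sub_self] at e
  refine mul_ne_zero ?_ (mul_ne_zero (pow_ne_zero k (G.totalEffect_one_pos hli).ne') (hκ l)) e.symm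
  exact (sub_pos.2 (one_lt_pow₀ (by norm_num : (1 : ℝ) < 2) hk)).ne'

end CausalGraph

namespace CausalGraph

variable {L O : Type*}

/-! ### Structure of admissible graphs -/

section Structure

variable {G : CausalGraph L O}

theorem Admissible.parent_unique (hG : G.Admissible) {x : O} {l l' : L}
    (h : G.Adj (Sum.inl l) (Sum.inr x)) (h' : G.Adj (Sum.inl l') (Sum.inr x)) : l = l' :=
  (hG.one_latent_parent x).unique h h'

theorem exists_of_reach_obs {x : O} {v : L ⊕ O} (h : G.Reach (Sum.inr x) v) :
    ∃ y, v = Sum.inr y := by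
  induction h with
  | refl => exact ⟨x, rfl⟩
  | @tail b c _ hbc ih =>
    obtain ⟨y, rfl⟩ := ih
    cases c with
    | inl l => exact absurd hbc (G.obs_not_to_latent y l)
    | inr z => exact ⟨z, rfl⟩

/-- An observed ancestor has the same latent parent. -/
theorem Admissible.parent_eq_of_reach (hG : G.Admissible) {x y : O} {l l' : L}
    (h : G.Reach (Sum.inr x) (Sum.inr y)) (hx : G.Adj (Sum.inl l) (Sum.inr x))
    (hy : G.Adj (Sum.inl l') (Sum.inr y)) : l = l' := by
  have key : ∀ v, G.Reach (Sum.inr x) v → ∀ z, v = Sum.inr z → G.Adj (Sum.inl l) (Sum.inr z) := by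
    intro v hv
    induction hv with
    | refl =>
      rintro z hz
      rwa [← hz]
    | @tail b c hb hbc ih =>
      rintro z rfl
      obtain ⟨t, rfl⟩ := exists_of_reach_obs hb
      obtain ⟨m, hm, -⟩ := hG.one_latent_parent z
      rwa [hG.no_edge_between_clusters t z l m hbc (ih t rfl) hm]
  exact hG.parent_unique (key _ h y rfl) hy

/-- A latent ancestor of an observed variable is an ancestor of, or equal to, its parent. -/
theorem Admissible.reach_parent (hG : G.Admissible) {m l : L} {x : O}
    (h : G.Reach (Sum.inl m) (Sum.inr x)) (hx : G.Adj (Sum.inl l) (Sum.inr x)) :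
    G.Reach (Sum.inl m) (Sum.inl l) := by
  have key : ∀ v, G.Reach (Sum.inl m) v → ∀ z l', v = Sum.inr z →
      G.Adj (Sum.inl l') (Sum.inr z) → G.Reach (Sum.inl m) (Sum.inl l') := by
    intro v hv
    induction hv with
    | refl => intro z l' hz; cases hz
    | @tail b c hb hbc ih =>
      rintro z l' rfl hl'
      cases b with
      | inl b => rwa [← hG.parent_unique hbc hl']
      | inr b =>
        obtain ⟨lb, hlb, -⟩ := hG.one_latent_parent b
        rw [← hG.no_edge_between_clusters b z lb l' hbc hlb hl']
        exact ih b lb rfl hlb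
  exact key _ h x l rfl hx

/-- A latent variable has an observed descendant other than any given child and any given
non-descendant. -/
theorem Admissible.exists_obs_descendant (hG : G.Admissible) {l : L} {x y : O}
    (hy : G.Adj (Sum.inl l) (Sum.inr y)) (hx : ¬ G.Reach (Sum.inl l) (Sum.inr x)) :
    ∃ c, c ≠ x ∧ c ≠ y ∧ G.Reach (Sum.inl l) (Sum.inr c) := by
  obtain ⟨d, hd, hdy⟩ : ∃ d, G.Adj (Sum.inl l) d ∧ d ≠ Sum.inr y := by
    obtain ⟨c, d, hcd, hc, hd⟩ := hG.two_children l
    by_cases h : c = Sum.inr y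
    · exact ⟨d, hd, fun h' => hcd (h.trans h'.symm)⟩
    · exact ⟨c, hc, h⟩
  cases d with
  | inr c =>
    refine ⟨c, ?_, fun h => hdy (by rw [h]), .single hd⟩
    rintro rfl
    exact hx (.single hd)
  | inl l' =>
    obtain ⟨c, hc⟩ := hG.observed_child l'
    have hr : G.Reach (Sum.inl l) (Sum.inr c) := (Relation.ReflTransGen.single hd).tail hc
    refine ⟨c, ?_, ?_, hr⟩
    · rintro rfl
      exact hx hr
    · rintro rfl
      exact G.ne_of_adj hd (congrArg Sum.inl (hG.parent_unique hy hc))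

theorem IsLatentSource.eq_of_reach {s : L} (hs : G.IsLatentSource s) {u : L ⊕ O}
    (h : G.Reach u (Sum.inl s)) : u = Sum.inl s := by
  rcases Relation.ReflTransGen.cases_tail h with h | ⟨b, -, hb⟩
  · exact h.symm
  · cases b with
    | inl b => exact absurd hb (hs b)
    | inr b => exact absurd hb (G.obs_not_to_latent b s)

theorem exists_latentSource_reach [Fintype L] [Fintype O] (G : CausalGraph L O) (l : L) :
    ∃ s, G.IsLatentSource s ∧ G.Reach (Sum.inl s) (Sum.inl l) := by
  induction hd : G.depth (Sum.inl l) using Nat.strong_induction_on generalizing l with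
  | _ d ih =>
    by_cases h : G.IsLatentSource l
    · exact ⟨l, h, .refl⟩
    · simp only [IsLatentSource, not_forall, not_not] at h
      obtain ⟨l', hl'⟩ := h
      obtain ⟨s, hs, hr⟩ := ih _ (hd ▸ G.depth_lt_of_adj hl') l' rfl
      exact ⟨s, hs, hr.tail hl'⟩

/-- If any two observed variables have a common ancestor, a latent source is an ancestor of all
latent variables. -/
theorem Admissible.latentSource_reach (hG : G.Admissible)
    (hdep : ∀ x y : O, x ≠ y → ∃ u, G.Reach u (Sum.inr x) ∧ G.Reach u (Sum.inr y))
    {s : L} (hs : G.IsLatentSource s) (l : L) : G.Reach (Sum.inl s) (Sum.inl l) := by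
  obtain ⟨x, hx⟩ := hG.observed_child s
  obtain ⟨y, hy⟩ := hG.observed_child l
  by_cases hxy : x = y
  · subst hxy
    rw [hG.parent_unique hx hy]
  · obtain ⟨u, hux, huy⟩ := hdep x y hxy
    cases u with
    | inl m =>
      have h1 := hs.eq_of_reach (hG.reach_parent hux hx)
      rw [← h1]
      exact hG.reach_parent huy hy
    -- An observed common ancestor shares its latent parent with both variables, so the two parents
    -- coincide.
    | inr z =>
      obtain ⟨m, hm, -⟩ := hG.one_latent_parent z
      rw [← hG.parent_eq_of_reach hux hm hx, hG.parent_eq_of_reach huy hm hy]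

/-- An observed variable without observed ancestors has its latent parent as only parent. -/
theorem Admissible.eq_parent_of_adj (hG : G.Admissible) {i : O} {l : L}
    (hl : G.Adj (Sum.inl l) (Sum.inr i)) (hi : ∀ y, ¬ G.ObsAnc y i) {x : L ⊕ O}
    (hx : G.Adj x (Sum.inr i)) : x = Sum.inl l := by
  cases x with
  | inl l' => rw [hG.parent_unique hx hl]
  | inr y => exact absurd (Relation.TransGen.single hx) (hi y)

end Structure

variable [Fintype L] [Fintype O]

theorem totalEffect_obs_eq_zero (G : CausalGraph L O) (w : G.Edge → ℝ) {x y : O} (hxy : y ≠ x)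
    (h : ¬ G.ObsAnc y x) : G.totalEffect w (Sum.inr x) (Sum.inr y) = 0 := by
  refine G.totalEffect_eq_zero w fun hr => ?_
  rcases Relation.reflTransGen_iff_eq_or_transGen.1 hr with h' | h'
  · exact hxy (Sum.inr_injective h').symm
  · exact h h'

/-- Both cumulant rows are combinations of the Vandermonde rows of α₀ and α₁, so the determinant is
a coefficient determinant times the Vandermonde determinant of α, α₀, α₁. -/
theorem minorDet_eq {Ω : Type*} [MeasurableSpace Ω] {μ : Measure Ω}
    (Y Z : Ω → ℝ) (r : Fin 2 → Fin 3) {α₀ α₁ : ℝ} {p q : Fin 3 → ℝ}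
    (h : ∀ r t : Fin 3, cumulantMatrix μ Y Z r t = α₀ ^ t.val * p r + α₁ ^ t.val * q r) (α : ℝ) :
    minorDet μ Y Z r α =
      (p (r 0) * q (r 1) - p (r 1) * q (r 0)) * ((α₀ - α) * (α₁ - α) * (α₁ - α₀)) := by
  simp only [minorDet, Matrix.det_fin_three, Matrix.of_apply]
  simp [h]
  ring

/-! ### The canonical model of a pair -/

section Pair

/-- The disturbances occurring in `X i` that are not merged with the disturbance of `X i` in the
canonical model over `X i` and `X j`. -/
def IsConfounding (G : CausalGraph L O) (w : G.Edge → ℝ) (i j : O) (u : L ⊕ O) : Prop :=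
  G.totalEffect w (Sum.inr i) u ≠ 0 ∧
    G.totalEffect w (Sum.inr j) u ≠
      G.totalEffect w (Sum.inr i) u * G.totalEffect w (Sum.inr j) (Sum.inr i)

variable {G : CausalGraph L O} {w : G.Edge → ℝ} {i j : O}

theorem IsConfounding.mergeClass_mem_conf {u : L ⊕ O} (h : G.IsConfounding w i j u)
    (hij : G.totalEffect w (Sum.inr i) (Sum.inr j) = 0) : G.mergeClass w i j u ∈ G.conf w i j := by
  refine ⟨u, Or.inl h.1, rfl, fun hi => h.2 ?_, fun hj => h.1 ?_⟩
  · have := hi.2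
    rw [totalEffect_self, one_mul] at this
    exact this.symm
  · have := hj.2
    rwa [totalEffect_self, hij, zero_mul, mul_one] at this

/-- With a single confounder, the confounding disturbances have proportional coefficients. -/
theorem IsConfounding.proportional (hconf : (G.conf w i j).ncard = 1)
    (hij : G.totalEffect w (Sum.inr i) (Sum.inr j) = 0) {u v : L ⊕ O}
    (hu : G.IsConfounding w i j u) (hv : G.IsConfounding w i j v) :
    G.totalEffect w (Sum.inr j) v =
      G.totalEffect w (Sum.inr j) u / G.totalEffect w (Sum.inr i) u *
        G.totalEffect w (Sum.inr i) v := by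
  obtain ⟨S, hS⟩ := Set.ncard_eq_one.1 hconf
  have h1 := hu.mergeClass_mem_conf hij
  have h2 := hv.mergeClass_mem_conf hij
  rw [hS, Set.mem_singleton_iff] at h1 h2
  have h3 : v ∈ G.mergeClass w i j v := ⟨Or.inl hv.1, rfl⟩
  rw [h2, ← h1] at h3
  have := h3.2
  have hne := hu.1
  field_simp
  linarith

/-- A disturbance absent from `X i` merges with that of `X j`; one present but not confounding
merges with that of `X i`. Only the class of `s` is left. -/
theorem conf_ncard_eq_one (hij : G.totalEffect w (Sum.inr i) (Sum.inr j) = 0) {s : L ⊕ O}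
    (hs : ∀ u, G.IsConfounding w i j u ↔ u = s) : (G.conf w i j).ncard = 1 := by
  refine Set.ncard_eq_one.2 ⟨G.mergeClass w i j s, Set.eq_singleton_iff_unique_mem.2
    ⟨((hs s).2 rfl).mergeClass_mem_conf hij, ?_⟩⟩
  rintro _ ⟨m, hocc, rfl, hi, hj⟩
  have hm : G.totalEffect w (Sum.inr i) m ≠ 0 := by
    intro h0
    exact hj ⟨Or.inr (by rw [totalEffect_self]; exact one_ne_zero), by rw [h0, hij]; ring⟩
  have : G.IsConfounding w i j m := by
    refine ⟨hm, fun h => hi ⟨Or.inl (by rw [totalEffect_self]; exact one_ne_zero), ?_⟩⟩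
    rw [totalEffect_self, one_mul, h]
  rw [(hs m).1 this]

/-! ### Own and confounding parts of the cumulants of a pair -/

variable {Ω : Type*} [MeasurableSpace Ω] {μ : Measure Ω} [IsProbabilityMeasure μ]
  {η : L ⊕ O → Ω → ℝ}

open Classical in
/-- The contribution of the confounding disturbances to the `n`-th cumulant of `X i`. -/
noncomputable def confounderCumulant (G : CausalGraph L O) (w : G.Edge → ℝ) (μ : Measure Ω)
    (η : L ⊕ O → Ω → ℝ) (i j : O) (n : ℕ) : ℝ :=
  ∑ u with G.IsConfounding w i j u,
    G.totalEffect w (Sum.inr i) u ^ n * jointCumulant μ fun _ : Fin n => η u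

open Classical in
/-- The contribution of the other disturbances to the `n`-th cumulant of `X i`. -/
noncomputable def ownCumulant (G : CausalGraph L O) (w : G.Edge → ℝ) (μ : Measure Ω)
    (η : L ⊕ O → Ω → ℝ) (i j : O) (n : ℕ) : ℝ :=
  ∑ u with ¬ G.IsConfounding w i j u,
    G.totalEffect w (Sum.inr i) u ^ n * jointCumulant μ fun _ : Fin n => η u

/-- With `a ≠ 0`, disturbances absent from `X i` drop out; each remaining one has ratio α₀ or α₁. -/
theorem pairCumulant_obs (hη : IsDisturbance μ η) {α₁ : ℝ}
    (hα : ∀ u, G.IsConfounding w i j u →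
      G.totalEffect w (Sum.inr j) u = α₁ * G.totalEffect w (Sum.inr i) u)
    {a b : ℕ} (ha : a ≠ 0) :
    pairCumulant μ (G.obs w η i) (G.obs w η j) a b =
      G.totalEffect w (Sum.inr j) (Sum.inr i) ^ b * G.ownCumulant w μ η i j (a + b) +
        α₁ ^ b * G.confounderCumulant w μ η i j (a + b) := by
  classical
  have h := pairCumulant_linearCombination hη.measurable hη.indep hη.moments (a := a) (b := b)
    (by omega) (G.totalEffect w (Sum.inr i)) (G.totalEffect w (Sum.inr j))
  have h' : pairCumulant μ (G.obs w η i) (G.obs w η j) a b = _ := h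
  rw [h', ← Finset.sum_filter_not_add_sum_filter _ fun u => G.IsConfounding w i j u, ownCumulant,
    confounderCumulant, Finset.mul_sum, Finset.mul_sum]
  congr 1
  · refine Finset.sum_congr rfl fun u hu => ?_
    have hu' : ¬ G.IsConfounding w i j u := (Finset.mem_filter.1 hu).2
    by_cases h0 : G.totalEffect w (Sum.inr i) u = 0
    · rw [h0, zero_pow ha, zero_pow (by omega : a + b ≠ 0)]
      ring
    · have : G.totalEffect w (Sum.inr j) u =
          G.totalEffect w (Sum.inr i) u * G.totalEffect w (Sum.inr j) (Sum.inr i) := by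
        by_contra hne
        exact hu' ⟨h0, hne⟩
      rw [this]
      ring
  · refine Finset.sum_congr rfl fun u hu => ?_
    rw [hα u (Finset.mem_filter.1 hu).2]
    ring

/-- The coefficients of the rows of the cumulant matrix with respect to the Vandermonde rows. -/
theorem cumulantMatrix_obs (hη : IsDisturbance μ η) {α₁ : ℝ}
    (hα : ∀ u, G.IsConfounding w i j u →
      G.totalEffect w (Sum.inr j) u = α₁ * G.totalEffect w (Sum.inr i) u) (r t : Fin 3) :
    cumulantMatrix μ (G.obs w η i) (G.obs w η j) r t =
      G.totalEffect w (Sum.inr j) (Sum.inr i) ^ t.val *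
        ![G.ownCumulant w μ η i j 3, G.ownCumulant w μ η i j 4,
          G.totalEffect w (Sum.inr j) (Sum.inr i) * G.ownCumulant w μ η i j 4] r +
      α₁ ^ t.val * ![G.confounderCumulant w μ η i j 3, G.confounderCumulant w μ η i j 4,
          α₁ * G.confounderCumulant w μ η i j 4] r := by
  have ht := t.isLt
  match r with
  | 0 =>
    change pairCumulant μ _ _ (3 - t.val) t.val = _
    rw [pairCumulant_obs hη hα (by omega), Nat.sub_add_cancel (by omega)]
    rfl
  | 1 =>
    change pairCumulant μ _ _ (4 - t.val) t.val = _
    rw [pairCumulant_obs hη hα (by omega), Nat.sub_add_cancel (by omega)]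
    rfl
  | 2 =>
    change pairCumulant μ _ _ (3 - t.val) (t.val + 1) = _
    rw [pairCumulant_obs hη hα (by omega), show 3 - t.val + (t.val + 1) = 4 by omega, pow_succ,
      pow_succ, mul_assoc, mul_assoc]
    rfl

/-- The estimated cumulant of a single confounder is the cumulant of its contribution. -/
theorem IsEstimatedCumulant.eq_confounderCumulant (hη : IsDisturbance μ η) {α₁ : ℝ}
    (hα : ∀ u, G.IsConfounding w i j u →
      G.totalEffect w (Sum.inr j) u = α₁ * G.totalEffect w (Sum.inr i) u)
    (hne : α₁ ≠ G.totalEffect w (Sum.inr j) (Sum.inr i)) {r : Fin 2 → Fin 3} {k : ℕ} (hk : 2 ≤ k)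
    {c : ℝ} (hc : G.IsEstimatedCumulant μ η w r k i j c) :
    c = G.confounderCumulant w μ η i j k := by
  obtain ⟨β, c₀, hβ, hroots, hsys⟩ := hc
  have hmem : α₁ ∈ {α | minorDet μ (G.obs w η i) (G.obs w η j) r α = 0} := by
    have := minorDet_eq (G.obs w η i) (G.obs w η j) r (cumulantMatrix_obs hη hα) α₁
    simp [this]
  rw [hroots] at hmem
  obtain rfl : α₁ = β := hmem.resolve_left hne
  have h0 := hsys 0 (by omega)
  have h1 := hsys 1 (by omega)
  rw [pairCumulant_obs hη hα (by omega), Nat.sub_add_cancel (by omega)] at h0 h1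
  -- Eliminating `c₀` from the equations m = 0 and m = 1 already determines `c`.
  have : (α₁ - G.totalEffect w (Sum.inr j) (Sum.inr i)) *
      (c - G.confounderCumulant w μ η i j k) = 0 := by
    linear_combination h1 - G.totalEffect w (Sum.inr j) (Sum.inr i) * h0
  exact sub_eq_zero.1 ((mul_eq_zero.1 this).resolve_left (sub_ne_zero.2 hne))

theorem isEstimatedCumulant_confounderCumulant (hη : IsDisturbance μ η) {α₁ : ℝ}
    (hα : ∀ u, G.IsConfounding w i j u →
      G.totalEffect w (Sum.inr j) u = α₁ * G.totalEffect w (Sum.inr i) u)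
    (hne : α₁ ≠ G.totalEffect w (Sum.inr j) (Sum.inr i)) {r : Fin 2 → Fin 3}
    (hr : Function.Injective r)
    (h01 : G.ownCumulant w μ η i j 3 * G.confounderCumulant w μ η i j 4 ≠
      G.ownCumulant w μ η i j 4 * G.confounderCumulant w μ η i j 3)
    (h02 : G.ownCumulant w μ η i j 3 * (α₁ * G.confounderCumulant w μ η i j 4) ≠
      G.totalEffect w (Sum.inr j) (Sum.inr i) * G.ownCumulant w μ η i j 4 *
        G.confounderCumulant w μ η i j 3)
    (h12 : G.ownCumulant w μ η i j 4 * G.confounderCumulant w μ η i j 4 ≠ 0) (k : ℕ) :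
    G.IsEstimatedCumulant μ η w r k i j (G.confounderCumulant w μ η i j k) := by
  refine ⟨α₁, G.ownCumulant w μ η i j k, hne, ?_, ?_⟩
  · ext α
    have hdet := minorDet_eq (G.obs w η i) (G.obs w η j) r (cumulantMatrix_obs hη hα) α
    set α₀ := G.totalEffect w (Sum.inr j) (Sum.inr i)
    set p₃ := G.ownCumulant w μ η i j 3
    set p₄ := G.ownCumulant w μ η i j 4
    set q₃ := G.confounderCumulant w μ η i j 3
    set q₄ := G.confounderCumulant w μ η i j 4
    -- The three coefficient determinants, one per choice of rows; that of the two fourth-order rows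
    -- is p₄ q₄ (α₁ - α₀).
    have hmain : ∀ a b : Fin 3, a ≠ b →
        ![p₃, p₄, α₀ * p₄] a * ![q₃, q₄, α₁ * q₄] b -
          ![p₃, p₄, α₀ * p₄] b * ![q₃, q₄, α₁ * q₄] a ≠ 0 := by
      have h12' : p₄ * (α₁ * q₄) - α₀ * p₄ * q₄ ≠ 0 := by
        have : p₄ * (α₁ * q₄) - α₀ * p₄ * q₄ = (p₄ * q₄) * (α₁ - α₀) := by ring
        rw [this]
        exact mul_ne_zero h12 (sub_ne_zero.2 hne)
      have h01' := sub_ne_zero.2 h01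
      have h02' := sub_ne_zero.2 h02
      intro a b hab
      fin_cases a <;> fin_cases b
      · exact absurd rfl hab
      · exact h01'
      · exact h02'
      · intro h; apply h01'; simp at h; linarith
      · exact absurd rfl hab
      · exact h12'
      · intro h; apply h02'; simp at h; linarith
      · intro h; apply h12'; simp at h; linarith
      · exact absurd rfl hab
    have hD := hmain (r 0) (r 1) fun h => by simpa using hr h
    simp only [Set.mem_ofPred_eq, Set.mem_insert_iff, Set.mem_singleton_iff]
    rw [hdet]
    simp only [mul_eq_zero, hD, sub_ne_zero.2 hne, false_or, or_false]
    rw [sub_eq_zero, sub_eq_zero, eq_comm, @eq_comm _ α₁]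
  · intro m hm
    rw [pairCumulant_obs hη hα (by omega), Nat.sub_add_cancel hm.le]

end Pair

end CausalGraph

namespace CausalGraph

variable {L O : Type*} [Fintype L] [Fintype O] {Ω : Type*} [MeasurableSpace Ω] {μ : Measure Ω}
  {G : CausalGraph L O} {η : L ⊕ O → Ω → ℝ} {w : G.Edge → ℝ}

/-! ### Estimated clusters -/

theorem measurable_obs (hη : ∀ v, Measurable (η v)) (x : O) : Measurable (G.obs w η x) :=
  Finset.measurable_fun_sum _ fun u _ => (hη u).const_mul _

theorem exists_common_ancestor (hη : IsDisturbance μ η) {x y : O}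
    (h : ¬ IndepFun (G.obs w η x) (G.obs w η y) μ) :
    ∃ u, G.Reach u (Sum.inr x) ∧ G.Reach u (Sum.inr y) := by
  by_contra! hcon
  refine h (indepFun_linearCombination hη.measurable hη.indep _ _ fun u => ?_)
  by_cases hu : G.Reach u (Sum.inr x)
  · exact Or.inr (G.totalEffect_eq_zero w (hcon u hu))
  · exact Or.inl (G.totalEffect_eq_zero w hu)

theorem covariance_obs [IsProbabilityMeasure μ] (hη : IsDisturbance μ η) (x y : O) :
    covariance (G.obs w η x) (G.obs w η y) μ =
      ∑ u, G.totalEffect w (Sum.inr x) u * G.totalEffect w (Sum.inr y) u * variance (η u) μ :=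
  covariance_linearCombination hη.indep hη.moments _ _

/-- Under the Triad constraint, the third-order cumulants are in the same ratio as the
covariances. -/
theorem Triad.cumulant_eq [IsProbabilityMeasure μ] (hη : IsDisturbance μ η) {a b c : O}
    (h : G.Triad μ η w a b c) :
    (∑ u, G.totalEffect w (Sum.inr a) u * G.totalEffect w (Sum.inr c) u ^ 2 *
        jointCumulant μ fun _ : Fin 3 => η u) *
      (∑ u, G.totalEffect w (Sum.inr b) u * G.totalEffect w (Sum.inr c) u * variance (η u) μ) =
    (∑ u, G.totalEffect w (Sum.inr b) u * G.totalEffect w (Sum.inr c) u ^ 2 *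
        jointCumulant μ fun _ : Fin 3 => η u) *
      ∑ u, G.totalEffect w (Sum.inr a) u * G.totalEffect w (Sum.inr c) u * variance (η u) μ := by
  obtain ⟨hne, hind⟩ := h
  set ρ := covariance (G.obs w η a) (G.obs w η c) μ / covariance (G.obs w η b) (G.obs w η c) μ
    with hρ
  have hZ : (fun ω => G.obs w η a ω - ρ * G.obs w η b ω) = fun ω =>
      ∑ u, (G.totalEffect w (Sum.inr a) u - ρ * G.totalEffect w (Sum.inr b) u) * η u ω := by
    funext ω
    simp only [obs, Finset.mul_sum, ← Finset.sum_sub_distrib]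
    exact Finset.sum_congr rfl fun u _ => by ring
  -- Independence of the Triad residual from `X c` kills their mixed cumulant of order (1, 2).
  have h1 : pairCumulant μ (fun ω => G.obs w η a ω - ρ * G.obs w η b ω) (G.obs w η c) 1 2 = 0 :=
    pairCumulant_eq_zero_of_indepFun
    (((measurable_obs hη.measurable a).sub ((measurable_obs hη.measurable b).const_mul ρ)))
    (measurable_obs hη.measurable c) hind (a := 1) (b := 2) one_ne_zero two_ne_zero
  rw [hZ] at h1
  have h3 := (pairCumulant_linearCombination hη.measurable hη.indep hη.moments (by norm_num) _
    (G.totalEffect w (Sum.inr c))).symm.trans h1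
  have h4 : ∑ u, G.totalEffect w (Sum.inr a) u * G.totalEffect w (Sum.inr c) u ^ 2 *
        (jointCumulant μ fun _ : Fin 3 => η u) =
      ρ * ∑ u, G.totalEffect w (Sum.inr b) u * G.totalEffect w (Sum.inr c) u ^ 2 *
        jointCumulant μ fun _ : Fin 3 => η u := by
    rw [← sub_eq_zero, ← h3, Finset.mul_sum, ← Finset.sum_sub_distrib]
    exact Finset.sum_congr rfl fun u _ => by ring
  rw [h4, ← covariance_obs hη, ← covariance_obs hη, hρ]
  field_simp

/-- The genericity conditions on the coefficients. -/
structure IsGenericCoef (G : CausalGraph L O) (μ : Measure Ω) (η : L ⊕ O → Ω → ℝ) (k : ℕ)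
    (w : G.Edge → ℝ) : Prop where
  totalEffect_ne_zero : ∀ v u, G.Reach u v → G.totalEffect w v u ≠ 0
  totalEffect_ne_mul : ∀ u v x, G.Adj u v → x ≠ u → x ≠ v →
    G.totalEffect w v u ≠ G.totalEffect w x u * G.totalEffect w v x
  cumulant_mul_ne : ∀ i s, i ≠ s →
    (jointCumulant μ fun _ : Fin 3 => η i) * (jointCumulant μ fun _ : Fin 4 => η s) *
        G.totalEffect w i s ≠
      (jointCumulant μ fun _ : Fin 4 => η i) * jointCumulant μ fun _ : Fin 3 => η s
  cumulant_mul_ne_of_adj : ∀ i j s, i ≠ j → i ≠ s → G.Adj s j →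
    (jointCumulant μ fun _ : Fin 3 => η i) * (jointCumulant μ fun _ : Fin 4 => η s) *
        G.totalEffect w j s ≠
      (jointCumulant μ fun _ : Fin 4 => η i) * (jointCumulant μ fun _ : Fin 3 => η s) *
        G.totalEffect w j i
  triad_ne : ∀ a b c l, b ≠ l → c ≠ l → ¬ G.Reach l a → G.Reach l b → G.Reach l c →
    (∃ u, G.Reach u a ∧ G.Reach u c) →
    (∑ u, G.totalEffect w a u * G.totalEffect w c u ^ 2 * jointCumulant μ fun _ : Fin 3 => η u) *
      (∑ u, G.totalEffect w b u * G.totalEffect w c u * variance (η u) μ) ≠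
    (∑ u, G.totalEffect w b u * G.totalEffect w c u ^ 2 * jointCumulant μ fun _ : Fin 3 => η u) *
      ∑ u, G.totalEffect w a u * G.totalEffect w c u * variance (η u) μ
  sum_pow_ne : ∀ i l s, ∀ S : Finset (L ⊕ O), l ∈ S → i ≠ l → s ≠ l → G.Reach l i →
    (∑ u ∈ S, G.totalEffect w i u ^ k * jointCumulant μ fun _ : Fin k => η u) ≠
      G.totalEffect w i s ^ k * jointCumulant μ fun _ : Fin k => η s

theorem generically_isGenericCoef [IsProbabilityMeasure μ] (G : CausalGraph L O)
    (hη : IsDisturbance μ η) {k : ℕ} (hk : 3 ≤ k) :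
    Generically fun w : G.Edge → ℝ => G.IsGenericCoef μ η k w := by
  have h₃ : ∀ u, (jointCumulant μ fun _ : Fin 3 => η u) ≠ 0 :=
    fun u => hη.cumulant_ne_zero u 3 le_rfl
  have h₄ : ∀ u, (jointCumulant μ fun _ : Fin 4 => η u) ≠ 0 :=
    fun u => hη.cumulant_ne_zero u 4 (by norm_num)
  have h₂ : ∀ u, 0 < variance (η u) μ := fun u =>
    variance_pos_of_continuous_law (hη.measurable u) (by exact_mod_cast hη.moments u 2)
      (hη.continuous_law u)
  obtain ⟨P, hP, hw⟩ := G.generically_totalEffect_ne_zero.and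
    (G.generically_totalEffect_ne_mul.and ((G.generically_mul_totalEffect_ne _ _ h₃ h₄).and
    ((G.generically_mul_totalEffect_ne_of_adj _ _ h₃ h₄).and
    ((G.generically_triad_ne _ _ h₂ h₃).and
    (G.generically_sum_pow_ne _ (fun u => hη.cumulant_ne_zero u k hk)
      (by omega : k ≠ 0))))))
  refine ⟨P, hP, fun w hne => ?_⟩
  obtain ⟨a, b, c, d, e, f⟩ := hw w hne
  exact ⟨a, b, c, d, e, f⟩

section Clusters

variable {k : ℕ}

/-- Generically, only variables with the same latent parent are merged. -/
theorem MergePair.parent_eq [IsProbabilityMeasure μ] (hG : G.Admissible) (hη : IsDisturbance μ η)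
    (hw : G.IsGenericCoef μ η k w) (hdep : G.MutuallyDependent μ η w) {x y : O}
    (h : G.MergePair μ η w x y) {l l' : L} (hx : G.Adj (Sum.inl l) (Sum.inr x))
    (hy : G.Adj (Sum.inl l') (Sum.inr y)) : l = l' := by
  obtain ⟨hxy, ⟨-, htri⟩ | h | h⟩ := h
  · by_contra hll
    -- By acyclicity one of the two parents is not an ancestor of the other variable. A further
    -- observed descendant of that parent serves as the third variable and violates the Triad
    -- identity.
    by_cases hr : G.Reach (Sum.inl l') (Sum.inl l)
    · have hr' : ¬ G.Reach (Sum.inl l) (Sum.inl l') := fun h =>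
        hll (Sum.inl_injective (h.antisymm hr))
      have hly : ¬ G.Reach (Sum.inl l) (Sum.inr y) := fun h => hr' (hG.reach_parent h hy)
      obtain ⟨c, hcy, hcx, hc⟩ := hG.exists_obs_descendant hx hly
      exact hw.triad_ne (Sum.inr y) (Sum.inr x) (Sum.inr c) (Sum.inl l) (by simp) (by simp) hly
        (.single hx) hc (exists_common_ancestor hη (hdep y c hcy.symm))
        ((htri c hcx hcy).cumulant_eq hη).symm
    · have hlx : ¬ G.Reach (Sum.inl l') (Sum.inr x) := fun h => hr (hG.reach_parent h hx)
      obtain ⟨c, hcx, hcy, hc⟩ := hG.exists_obs_descendant hy hlx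
      exact hw.triad_ne (Sum.inr x) (Sum.inr y) (Sum.inr c) (Sum.inl l') (by simp) (by simp) hlx
        (.single hy) hc (exists_common_ancestor hη (hdep x c hcx.symm))
        ((htri c hcx hcy).cumulant_eq hη)
  · exact hG.parent_eq_of_reach h.to_reflTransGen hx hy
  · exact (hG.parent_eq_of_reach h.to_reflTransGen hy hx).symm

theorem SameCluster.parent_eq [IsProbabilityMeasure μ] (hG : G.Admissible) (hη : IsDisturbance μ η)
    (hw : G.IsGenericCoef μ η k w) (hdep : G.MutuallyDependent μ η w) {x y : O}
    (h : G.SameCluster μ η w x y) {l l' : L} (hx : G.Adj (Sum.inl l) (Sum.inr x))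
    (hy : G.Adj (Sum.inl l') (Sum.inr y)) : l = l' := by
  induction h generalizing l l' with
  | rel x y h => exact h.parent_eq hG hη hw hdep hx hy
  | refl x => exact hG.parent_unique hx hy
  | symm x y _ ih => exact (ih hy hx).symm
  | trans x y z _ _ ih₁ ih₂ =>
    obtain ⟨m, hm, -⟩ := hG.one_latent_parent y
    exact (ih₁ hx hm).trans (ih₂ hm hy)

theorem IsRepresentatives.not_obsAnc {oc : Finset O} (hoc : G.IsRepresentatives μ η w oc) {r : O}
    (hr : r ∈ oc) (y : O) : ¬ G.ObsAnc y r := by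
  intro h
  refine hoc.highest r hr y (.rel _ _ ⟨?_, Or.inr (Or.inr h)⟩) h
  rintro rfl
  exact G.acyclic _ h

theorem IsRepresentatives.eq_of_sameCluster {oc : Finset O} (hoc : G.IsRepresentatives μ η w oc)
    {r r' : O} (hr : r ∈ oc) (hr' : r' ∈ oc) (h : G.SameCluster μ η w r r') : r = r' :=
  (hoc.unique_rep r').unique ⟨hr, h⟩ ⟨hr', .refl _⟩

end Clusters

/-! ### Pairs of observed variables under generic coefficients -/

section GenericPairs

variable {k : ℕ} {i j : O} {s : L}

theorem isConfounding_of_not_obsAnc (hw : G.IsGenericCoef μ η k w) (hij : i ≠ j)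
    (hanc : ¬ G.ObsAnc i j) {u : L ⊕ O} (hui : G.Reach u (Sum.inr i))
    (huj : G.Reach u (Sum.inr j)) : G.IsConfounding w i j u := by
  refine ⟨hw.totalEffect_ne_zero _ _ hui, ?_⟩
  rw [G.totalEffect_obs_eq_zero w hij hanc, mul_zero]
  exact hw.totalEffect_ne_zero _ _ huj

theorem isConfounding_of_common_parent (hw : G.IsGenericCoef μ η k w) (hij : i ≠ j)
    {l : L} (hi : G.Adj (Sum.inl l) (Sum.inr i)) (hj : G.Adj (Sum.inl l) (Sum.inr j)) :
    G.IsConfounding w i j (Sum.inl l) :=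
  ⟨hw.totalEffect_ne_zero _ _ (.single hi),
    hw.totalEffect_ne_mul _ _ _ hj (by simp) (by simpa using hij)⟩

/-- If the parent of `X i` is a latent source, only the disturbance of this source occurs in `X i`
besides that of `X i` itself. -/
theorem eq_of_totalEffect_ne_zero_of_source (hG : G.Admissible) (hs : G.IsLatentSource s)
    (hsi : G.Adj (Sum.inl s) (Sum.inr i)) (hi : ∀ y, ¬ G.ObsAnc y i) {u : L ⊕ O}
    (hu : G.totalEffect w (Sum.inr i) u ≠ 0) : u = Sum.inr i ∨ u = Sum.inl s := by
  by_cases h : u = Sum.inr i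
  · exact Or.inl h
  · rw [G.totalEffect_of_unique_parent w (fun x hx => hG.eq_parent_of_adj hsi hi hx) (by simp)
      (Ne.symm h)] at hu
    exact Or.inr (hs.eq_of_reach (G.reach_of_totalEffect_ne_zero (right_ne_zero_of_mul hu)))

theorem isConfounding_iff_of_source (hG : G.Admissible) (hs : G.IsLatentSource s)
    (hsi : G.Adj (Sum.inl s) (Sum.inr i)) (hi : ∀ y, ¬ G.ObsAnc y i)
    (hsj : G.IsConfounding w i j (Sum.inl s)) (u : L ⊕ O) :
    G.IsConfounding w i j u ↔ u = Sum.inl s := by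
  refine ⟨fun hu => ?_, fun h => h ▸ hsj⟩
  refine (eq_of_totalEffect_ne_zero_of_source hG hs hsi hi hu.1).resolve_left ?_
  rintro rfl
  exact hu.2 (by rw [totalEffect_self, one_mul])

theorem confounderCumulant_of_iff {u₀ : L ⊕ O} (h : ∀ u, G.IsConfounding w i j u ↔ u = u₀)
    (n : ℕ) : G.confounderCumulant w μ η i j n =
      G.totalEffect w (Sum.inr i) u₀ ^ n * jointCumulant μ fun _ : Fin n => η u₀ := by
  classical
  simp only [confounderCumulant, h]
  rw [Finset.filter_eq', if_pos (Finset.mem_univ _), Finset.sum_singleton]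

theorem ownCumulant_of_source (hG : G.Admissible) (hs : G.IsLatentSource s)
    (hsi : G.Adj (Sum.inl s) (Sum.inr i)) (hi : ∀ y, ¬ G.ObsAnc y i)
    (hsj : G.IsConfounding w i j (Sum.inl s)) {n : ℕ} (hn : n ≠ 0) :
    G.ownCumulant w μ η i j n = jointCumulant μ fun _ : Fin n => η (Sum.inr i) := by
  classical
  simp only [ownCumulant, isConfounding_iff_of_source hG hs hsi hi hsj]
  rw [Finset.sum_eq_single (Sum.inr i)]
  · rw [totalEffect_self, one_pow, one_mul]
  · intro u hu hui
    have h0 : G.totalEffect w (Sum.inr i) u = 0 := by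
      by_contra hne
      exact (eq_of_totalEffect_ne_zero_of_source hG hs hsi hi hne).elim hui
        (Finset.mem_filter.1 hu).2
    rw [h0, zero_pow hn, zero_mul]
  · simp

/-- If the parent of `X i` is a latent source, the estimated cumulant is that of this source. -/
theorem isEstimatedCumulant_of_source [IsProbabilityMeasure μ] (hG : G.Admissible)
    (hη : IsDisturbance μ η)
    (hw : G.IsGenericCoef μ η k w) (hs : G.IsLatentSource s)
    (hsi : G.Adj (Sum.inl s) (Sum.inr i)) (hi : ∀ y, ¬ G.ObsAnc y i) (hij : i ≠ j)
    (hj : ¬ G.ObsAnc i j ∧ G.Reach (Sum.inl s) (Sum.inr j) ∨ G.Adj (Sum.inl s) (Sum.inr j))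
    (hsj : G.IsConfounding w i j (Sum.inl s)) {r : Fin 2 → Fin 3} (hr : Function.Injective r) :
    G.IsEstimatedCumulant μ η w r k i j (G.totalEffect w (Sum.inr i) (Sum.inl s) ^ k *
      jointCumulant μ fun _ : Fin k => η (Sum.inl s)) := by
  have hiff := isConfounding_iff_of_source hG hs hsi hi hsj
  have hlam := hsj.1
  rw [← confounderCumulant_of_iff hiff]
  have h₃ : ∀ u, (jointCumulant μ fun _ : Fin 3 => η u) ≠ 0 :=
    fun u => hη.cumulant_ne_zero u 3 le_rfl
  have h₄ : ∀ u, (jointCumulant μ fun _ : Fin 4 => η u) ≠ 0 :=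
    fun u => hη.cumulant_ne_zero u 4 (by norm_num)
  refine isEstimatedCumulant_confounderCumulant hη
    (α₁ := G.totalEffect w (Sum.inr j) (Sum.inl s) / G.totalEffect w (Sum.inr i) (Sum.inl s))
    ?_ ?_ hr ?_ ?_ ?_ k
  · intro u hu
    rw [(hiff u).1 hu, div_mul_cancel₀ _ hlam]
  · rw [ne_eq, div_eq_iff hlam, mul_comm]
    exact hsj.2
  all_goals
    simp only [confounderCumulant_of_iff hiff,
      ownCumulant_of_source hG hs hsi hi hsj (n := 3) (by norm_num),
      ownCumulant_of_source hG hs hsi hi hsj (n := 4) (by norm_num)]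
  · intro h
    refine hw.cumulant_mul_ne (Sum.inr i) (Sum.inl s) (by simp) ?_
    refine mul_left_cancel₀ (pow_ne_zero 3 hlam) ?_
    linear_combination h
  · have key : (jointCumulant μ fun _ : Fin 3 => η (Sum.inr i)) *
        (jointCumulant μ fun _ : Fin 4 => η (Sum.inl s)) *
          G.totalEffect w (Sum.inr j) (Sum.inl s) ≠
        (jointCumulant μ fun _ : Fin 4 => η (Sum.inr i)) *
          (jointCumulant μ fun _ : Fin 3 => η (Sum.inl s)) *
          G.totalEffect w (Sum.inr j) (Sum.inr i) := by
      -- Either `X i` has no effect on `X j` and the right side is zero, or `X j` is a child of the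
      -- source and the edge condition applies.
      rcases hj with ⟨hanc, hreach⟩ | hadj
      · rw [G.totalEffect_obs_eq_zero w hij hanc, mul_zero]
        exact mul_ne_zero (mul_ne_zero (h₃ _) (h₄ _)) (hw.totalEffect_ne_zero _ _ hreach)
      · exact hw.cumulant_mul_ne_of_adj _ _ _ (by simpa using hij) (by simp) hadj
    intro h
    refine key (mul_left_cancel₀ (pow_ne_zero 3 hlam) ?_)
    field_simp at h
    linear_combination G.totalEffect w (Sum.inr i) (Sum.inl s) ^ 3 * h
  · exact mul_ne_zero (h₄ _) (mul_ne_zero (pow_ne_zero 4 hlam) (h₄ _))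

/-- A common value of the estimated cumulants excludes that one pair is confounded by a single
disturbance and another one by a further disturbance. -/
theorem not_isEstimatedCumulant_of_isConfounding [IsProbabilityMeasure μ] (hη : IsDisturbance μ η)
    (hw : G.IsGenericCoef μ η k w) (hk : 3 ≤ k) {l : L} {j' : O} {r : Fin 2 → Fin 3}
    (hij : G.totalEffect w (Sum.inr i) (Sum.inr j) = 0)
    (hij' : G.totalEffect w (Sum.inr i) (Sum.inr j') = 0)
    (hconf : (G.conf w i j).ncard = 1) (hconf' : (G.conf w i j').ncard = 1)
    (hs : ∀ u, G.IsConfounding w i j u ↔ u = Sum.inl s) (hsl : s ≠ l)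
    (hl : G.IsConfounding w i j' (Sum.inl l)) {c : ℝ}
    (hc : G.IsEstimatedCumulant μ η w r k i j c)
    (hc' : G.IsEstimatedCumulant μ η w r k i j' c) : False := by
  classical
  have key : ∀ {z : O} {u : L ⊕ O}, G.totalEffect w (Sum.inr i) (Sum.inr z) = 0 →
      (G.conf w i z).ncard = 1 → G.IsConfounding w i z u →
      G.IsEstimatedCumulant μ η w r k i z c → c = G.confounderCumulant w μ η i z k := by
    intro z u hz hcz hu hcc
    refine hcc.eq_confounderCumulant hη
      (α₁ := G.totalEffect w (Sum.inr z) u / G.totalEffect w (Sum.inr i) u)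
      (fun v hv => hu.proportional hcz hz hv) ?_ (by omega)
    rw [ne_eq, div_eq_iff hu.1, mul_comm]
    exact hu.2
  have e := key hij hconf ((hs _).2 rfl) hc
  have e' := key hij' hconf' hl hc'
  rw [confounderCumulant_of_iff hs] at e
  refine hw.sum_pow_ne (Sum.inr i) (Sum.inl l) (Sum.inl s)
    (Finset.univ.filter fun u => G.IsConfounding w i j' u) (by simpa using hl) (by simp)
    (by simpa using hsl) (G.reach_of_totalEffect_ne_zero hl.1) ?_
  rw [← e, e']
  rfl

end GenericPairs

end CausalGraph

/-! ### The characterisation of latent sources -/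

open CausalGraph in
theorem mainTheorem4 {L O Ω : Type*} [Fintype L] [Fintype O] [DecidableEq O]
    [MeasurableSpace Ω] (μ : Measure Ω) [IsProbabilityMeasure μ]
    (G : CausalGraph L O) (hG : G.Admissible)
    (η : L ⊕ O → Ω → ℝ) (hη : IsDisturbance μ η)
    (k : ℕ) (hk : 3 ≤ k) (r : Fin 2 → Fin 3) (hr : Function.Injective r) :
    ∃ P : MvPolynomial G.Edge ℝ, P ≠ 0 ∧
      ∀ w : G.Edge → ℝ, MvPolynomial.eval w P ≠ 0 →
        G.MutuallyDependent μ η w →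
        ∀ oc : Finset O, G.IsRepresentatives μ η w oc → 2 ≤ oc.card →
        ∀ i ∈ oc, ∀ C : Finset O, G.IsCompanionSet μ η w i C →
        ∀ l : L, G.Adj (Sum.inl l) (Sum.inr i) →
          (G.IsLatentSource l ↔
            (C = ∅ ∧ (oc.erase i).card = 1) ∨
            (2 ≤ ((oc ∪ C).erase i).card ∧
              (∀ j ∈ (oc ∪ C).erase i,
                ¬ IndepFun (G.obs w η i) (G.obs w η j) μ → (G.conf w i j).ncard = 1) ∧
              ∃ c : ℝ, ∀ j ∈ (oc ∪ C).erase i, G.IsEstimatedCumulant μ η w r k i j c)) := by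
  obtain ⟨P, hP, hgen⟩ := G.generically_isGenericCoef hη hk
  refine ⟨P, hP, fun w hPw hdep oc hoc hcard i hi C hC l hl => ?_⟩
  have hw : G.IsGenericCoef μ η k w := hgen w hPw
  have hianc := hoc.not_obsAnc hi
  have hcommon : ∀ x y : O, x ≠ y → ∃ u, G.Reach u (Sum.inr x) ∧ G.Reach u (Sum.inr y) :=
    fun x y hxy => exists_common_ancestor hη (hdep x y hxy)
  have hTi : ∀ j, i ≠ j → G.totalEffect w (Sum.inr i) (Sum.inr j) = 0 := fun j hij =>
    G.totalEffect_obs_eq_zero w hij.symm (hianc j)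
  -- the companion has the same latent parent
  have hCpar : ∀ j ∈ C, i ≠ j ∧ G.SameCluster μ η w i j ∧ G.Adj (Sum.inl l) (Sum.inr j) := by
    intro j hj
    rcases hC with ⟨i', hsame, hne, rfl⟩ | ⟨-, rfl⟩
    · rw [Finset.mem_singleton] at hj
      subst hj
      obtain ⟨m, hm, -⟩ := hG.one_latent_parent j
      have := hsame.parent_eq hG hη hw hdep hl hm
      exact ⟨hne.symm, hsame, this ▸ hm⟩
    · simp at hj
  have hrep : ∀ (y : O) (m : L), G.Adj (Sum.inl m) (Sum.inr y) →
      ∃ j ∈ oc, G.SameCluster μ η w j y ∧ G.Adj (Sum.inl m) (Sum.inr j) := by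
    intro y m hm
    obtain ⟨j, ⟨hj, hsame⟩, -⟩ := hoc.unique_rep y
    obtain ⟨m', hm', -⟩ := hG.one_latent_parent j
    have := hsame.parent_eq hG hη hw hdep hm' hm
    exact ⟨j, hj, hsame, this ▸ hm'⟩
  constructor
  · intro hs
    have hreach := hG.latentSource_reach hcommon hs
    have hcases : ∀ j ∈ (oc ∪ C).erase i, i ≠ j ∧
        (¬ G.ObsAnc i j ∧ G.Reach (Sum.inl l) (Sum.inr j) ∨ G.Adj (Sum.inl l) (Sum.inr j)) ∧
        G.IsConfounding w i j (Sum.inl l) := by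
      intro j hj
      obtain ⟨hji, hj⟩ := Finset.mem_erase.1 hj
      rcases Finset.mem_union.1 hj with hj | hj
      · obtain ⟨m, hm, -⟩ := hG.one_latent_parent j
        have hlj : G.Reach (Sum.inl l) (Sum.inr j) := (hreach m).tail hm
        exact ⟨hji.symm, Or.inl ⟨hoc.not_obsAnc hj i, hlj⟩,
          isConfounding_of_not_obsAnc hw hji.symm (hoc.not_obsAnc hj i) (.single hl) hlj⟩
      · obtain ⟨-, -, hlj⟩ := hCpar j hj
        exact ⟨hji.symm, Or.inr hlj, isConfounding_of_common_parent hw hji.symm hl hlj⟩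
    by_cases hcard' : 2 ≤ ((oc ∪ C).erase i).card
    · refine Or.inr ⟨hcard', fun j hj _ => ?_, G.totalEffect w (Sum.inr i) (Sum.inl l) ^ k *
        jointCumulant μ fun _ : Fin k => η (Sum.inl l), fun j hj => ?_⟩
      · obtain ⟨hij, -, hconf⟩ := hcases j hj
        exact conf_ncard_eq_one (hTi j hij) (isConfounding_iff_of_source hG hs hl hianc hconf)
      · obtain ⟨hij, hor, hconf⟩ := hcases j hj
        exact isEstimatedCumulant_of_source hG hη hw hs hl hianc hij hor hconf hr
    -- A companion is never a representative, so together with a second representative it would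
    -- already give two elements.
    · refine Or.inl ?_
      have hoc1 : 1 ≤ (oc.erase i).card := by
        rw [Finset.card_erase_of_mem hi]
        omega
      have hsub : oc.erase i ⊆ (oc ∪ C).erase i :=
        Finset.erase_subset_erase i Finset.subset_union_left
      have hle := Finset.card_le_card hsub
      refine ⟨Finset.eq_empty_of_forall_notMem fun j hj => ?_, by omega⟩
      obtain ⟨hij, hsame, -⟩ := hCpar j hj
      have hjoc : j ∉ oc := fun h => hij (hoc.eq_of_sameCluster hi h hsame)
      have hlt : (oc.erase i).card < ((oc ∪ C).erase i).card := by
        refine Finset.card_lt_card ((Finset.ssubset_iff_of_subset hsub).2 ⟨j, ?_, ?_⟩)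
        · exact Finset.mem_erase.2 ⟨hij.symm, Finset.mem_union_right _ hj⟩
        · exact fun h => hjoc (Finset.mem_of_mem_erase h)
      omega
  · intro h
    by_contra hnot
    obtain ⟨s, hs, hsl⟩ := G.exists_latentSource_reach l
    have hne : s ≠ l := by rintro rfl; exact hnot hs
    obtain ⟨x, hx⟩ := hG.observed_child s
    obtain ⟨j, hj, -, hsj⟩ := hrep x s hx
    have hij : i ≠ j := by
      rintro rfl
      exact hne (hG.parent_unique hsj hl)
    -- `X j` contains only its own disturbance, which does not occur in `X i`, and that of `s`.
    have hsj' : ∀ u, G.IsConfounding w i j u ↔ u = Sum.inl s := by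
      intro u
      refine ⟨fun hu => ?_, ?_⟩
      · have h0 := hu.2
        rw [G.totalEffect_obs_eq_zero w hij (hoc.not_obsAnc hj i), mul_zero] at h0
        refine (eq_of_totalEffect_ne_zero_of_source hG hs hsj (hoc.not_obsAnc hj) h0).resolve_left ?_
        rintro rfl
        exact hu.1 (hTi j hij)
      · rintro rfl
        exact isConfounding_of_not_obsAnc hw hij (hoc.not_obsAnc hj i) (hsl.tail hl) (.single hsj)
    -- a further variable confounded with `X i` by its own latent parent
    obtain ⟨d, hd, hdi⟩ : ∃ d, G.Adj (Sum.inl l) d ∧ d ≠ Sum.inr i := by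
      obtain ⟨c, d, hcd, hc, hd⟩ := hG.two_children l
      by_cases h : c = Sum.inr i
      · exact ⟨d, hd, fun h' => hcd (h.trans h'.symm)⟩
      · exact ⟨c, hc, h⟩
    obtain ⟨y, m, hyi, hly, hmy, hms⟩ : ∃ (y : O) (m : L), y ≠ i ∧
        G.Reach (Sum.inl l) (Sum.inl m) ∧ G.Adj (Sum.inl m) (Sum.inr y) ∧ m ≠ s := by
      cases d with
      | inr y => exact ⟨y, l, fun h => hdi (by rw [h]), .refl, hd, hne.symm⟩
      | inl m =>
        obtain ⟨y, hy⟩ := hG.observed_child m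
        refine ⟨y, m, ?_, .single hd, hy, ?_⟩
        · rintro rfl
          exact G.ne_of_adj hd (congrArg Sum.inl (hG.parent_unique hl hy))
        · rintro rfl
          exact hs l hd
    obtain ⟨j', hj', hsame, hmj'⟩ := hrep y m hmy
    rcases h with ⟨rfl, hcard1⟩ | ⟨-, hconf, c, hc⟩
    · have hsingle : ∀ z, G.SameCluster μ η w i z → z = i := by
        rcases hC with ⟨i', -, -, h⟩ | ⟨h, -⟩
        · simp at h
        · exact h
      have hij' : i ≠ j' := by
        rintro rfl
        exact hyi (hsingle y hsame)
      obtain ⟨z, hz⟩ := Finset.card_eq_one.1 hcard1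
      have h1 : j ∈ oc.erase i := Finset.mem_erase.2 ⟨hij.symm, hj⟩
      have h2 : j' ∈ oc.erase i := Finset.mem_erase.2 ⟨hij'.symm, hj'⟩
      rw [hz, Finset.mem_singleton] at h1 h2
      subst h1
      subst h2
      exact hms (hG.parent_unique hmj' hsj)
    · have hjmem : j ∈ (oc ∪ C).erase i :=
        Finset.mem_erase.2 ⟨hij.symm, Finset.mem_union_left _ hj⟩
      obtain ⟨z, hz, hiz, hlz⟩ : ∃ z ∈ (oc ∪ C).erase i, i ≠ z ∧
          G.IsConfounding w i z (Sum.inl l) := by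
        -- If the further variable is represented by `X i` itself, its cluster has a second member,
        -- and the companion takes its place.
        by_cases hij' : i = j'
        · subst hij'
          rcases hC with ⟨i', -, hne', rfl⟩ | ⟨h, -⟩
          · exact ⟨i', Finset.mem_erase.2 ⟨hne', Finset.mem_union_right _ (by simp)⟩, hne'.symm,
              isConfounding_of_common_parent hw hne'.symm hl (hCpar i' (by simp)).2.2⟩
          · exact absurd (h y hsame) hyi
        · exact ⟨j', Finset.mem_erase.2 ⟨Ne.symm hij', Finset.mem_union_left _ hj'⟩, hij',
            isConfounding_of_not_obsAnc hw hij' (hoc.not_obsAnc hj' i) (.single hl)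
              (hly.tail hmj')⟩
      exact not_isEstimatedCumulant_of_isConfounding hη hw hk (hTi j hij) (hTi z hiz)
        (hconf j hjmem (hdep i j hij)) (hconf z hz (hdep i z hiz)) hsj' hne hlz (hc j hjmem)
        (hc z hz)
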